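/- **Setting.** All random elements take values in Polish spaces with their Borel $\sigma$-algebras. For each $n\in\mathbb N$, on a probability space $(\Omega_n,\mathcal F_n,P_n)$, let $D_n$ (the data) and $W_n^*$ (auxiliary variates) be random elements, let $\tau_n=\tau_n(D_n)$ and $\tau_n^*=\tau_n^*(D_n,W_n^*)$ be real random variables that are measurable functions of $D_n$ and of $(D_n,W_n^*)$ respectively, and let $X_n$ be a $D_n$-measurable random element. Let $p_n^*:=P(\tau_n^*\le\tau_n\mid D_n)$ be the bootstrap $p$-value. For random elements $Y_n$ on $\Omega_n$, the bootstrap based on $\tau_n$ and $\tau_n^*$ is called *valid conditionally on $Y_n$* if $$P(p_n^*\le q\mid Y_n)\xrightarrow{p}q\qquad\text{for all }q\in(0,1).$$ Let $\tau$ be a real random variable and $X,X'$ random elements on a common probability space. Conditional cdfs are computed from regular conditional distributions. Write $\xrightarrow{w}$ for convergence in distribution. The notation $$(\tau_n|X_n,\ \tau_n^*|D_n)\xrightarrow{w}_w(\tau|X,\ \tau|X')\tag{1}$$ means that $$\big(E\{g(\tau_n)|X_n\},E\{h(\tau_n^*)|D_n\}\big)\xrightarrow{w}\big(E\{g(\tau)|X\},E\{h(\tau)|X'\}\big)\quad\text{in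 }\mathbb R^2$$ for all bounded continuous $g,h:\mathbb R\to\mathbb R$. Random elements $V_n$ of a Polish space are said to satisfy $V_n\xrightarrow{w}V$ *jointly with* (1) if, for all such $g,h$, $$\big(E\{g(\tau_n)|X_n\},E\{h(\tau_n^*)|D_n\},V_n\big)\xrightarrow{w}\big(E\{g(\tau)|X\},E\{h(\tau)|X'\},V\big).$$ Likewise, $Z_n|Y_n\xrightarrow{w}_wZ|Y$ means that $E\{h(Z_n)|Y_n\}\xrightarrow{w}E\{h(Z)|Y\}$ for all bounded continuous real $h$. **Corollary.** Assume (1), and assume that the random cdfs $F(u):=P(\tau\le u|X)$ and $F^*(u):=P(\tau\le u|X')$, $u\in\mathbb R$, are sample-path continuous (almost surely). (a) If $X'=X$, then the bootstrap based on $\tau_n$ and $\tau_n^*$ is valid conditionally on $X_n$, and $$\sup_{u\in\mathbb R}\big|P(\tau_n\le u|X_n)-P(\tau_n^*\le u|D_n)\big|\xrightarrow{p}0 .$$ (b) Suppose that $X=(X',X'')$, that $(X_n',X_n'')\xrightarrow{w}(X',X'')$ jointly with (1) for some $X_n$-measurable random elements $(X_n',X_n'')$, and that $X_n''|X_n'\xrightarrow{w}_wX''|X'$.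 Then the bootstrap based on $\tau_n$ and $\tau_n^*$ is valid conditionally on $X_n'$, and $$\sup_{u\in\mathbb R}\big|P(\tau_n\le u|X_n')-P(\tau_n^*\le u|D_n)\big|\xrightarrow{p}0 .$$ -/

import Mathlib

open MeasureTheory ProbabilityTheory Filter
open scoped Topology BoundedContinuousFunction

/-- The σ-algebra `σ(X)` generated by a random element `X`. -/
abbrev sigmaOf {Ω S : Type*} [MeasurableSpace S] (X : Ω → S) : MeasurableSpace Ω :=
  MeasurableSpace.comap X inferInstance

/-- The conditional expectation `E{h(Z) | X}` under `P`, as a random variable. -/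
noncomputable def condMean {Ω S 𝓧 : Type*} [MeasurableSpace Ω] [TopologicalSpace S]
    [MeasurableSpace 𝓧] (P : Measure Ω) (h : S →ᵇ ℝ) (Z : Ω → S) (X : Ω → 𝓧) : Ω → ℝ :=
  P[fun ω => h (Z ω) | sigmaOf X]

/-- The random cdf `u ↦ P(Z ≤ u | X)` at the outcome `ω`, computed from the regular conditional
distribution of `Z` given `X`. -/
noncomputable def randomCdf {Ω 𝓧 : Type*} [MeasurableSpace Ω] [MeasurableSpace 𝓧]
    (P : Measure Ω) [IsFiniteMeasure P] (Z : Ω → ℝ) (X : Ω → 𝓧) (ω : Ω) (u : ℝ) : ℝ :=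
  (condDistrib Z X P (X ω)).real (Set.Iic u)

/-- Almost all sample paths of the random cdf `P(Z ≤ · | X)` are continuous. -/
def SamplePathContinuousCdf {Ω 𝓧 : Type*} [MeasurableSpace Ω] [MeasurableSpace 𝓧]
    (P : Measure Ω) [IsFiniteMeasure P] (Z : Ω → ℝ) (X : Ω → 𝓧) : Prop :=
  ∀ᵐ ω ∂P, Continuous (randomCdf P Z X ω)

/-- Convergence in probability, to the constant `c`, of random variables `Y n` that may live on
different probability spaces. -/
def TendstoInProb {Ω : ℕ → Type*} [∀ n, MeasurableSpace (Ω n)] (P : ∀ n, Measure (Ω n))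
    (Y : ∀ n, Ω n → ℝ) (c : ℝ) : Prop :=
  ∀ ε : ℝ, 0 < ε → Tendsto (fun n => P n {ω | ε ≤ |Y n ω - c|}) atTop (𝓝 0)

/-- Weak convergence in distribution `Zₙ | Xₙ →_w Z | X`: for every bounded continuous `h`,
`E{h(Zₙ) | Xₙ}` converges in distribution to `E{h(Z) | X}`. -/
def CondWeakConv {Ω : ℕ → Type*} [∀ n, MeasurableSpace (Ω n)]
    (P : ∀ n, Measure (Ω n)) [∀ n, IsProbabilityMeasure (P n)]
    {Ω₀ : Type*} [MeasurableSpace Ω₀] (P₀ : Measure Ω₀) [IsProbabilityMeasure P₀]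
    {S : Type*} [TopologicalSpace S]
    {𝓧 : ℕ → Type*} [∀ n, MeasurableSpace (𝓧 n)] {𝓧₀ : Type*} [MeasurableSpace 𝓧₀]
    (Zn : ∀ n, Ω n → S) (Xn : ∀ n, Ω n → 𝓧 n) (Z : Ω₀ → S) (X : Ω₀ → 𝓧₀) : Prop :=
  ∀ h : S →ᵇ ℝ,
    TendstoInDistribution (fun n => condMean (P n) h (Zn n) (Xn n)) atTop (condMean P₀ h Z X) P P₀

/-- Joint weak convergence in distribution
`(Z₁ₙ | X₁ₙ, Z₂ₙ | X₂ₙ) →_w (Z₁ | X₁, Z₂ | X₂)`. -/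
def JointCondWeakConv {Ω : ℕ → Type*} [∀ n, MeasurableSpace (Ω n)]
    (P : ∀ n, Measure (Ω n)) [∀ n, IsProbabilityMeasure (P n)]
    {Ω₀ : Type*} [MeasurableSpace Ω₀] (P₀ : Measure Ω₀) [IsProbabilityMeasure P₀]
    {S₁ S₂ : Type*} [TopologicalSpace S₁] [TopologicalSpace S₂]
    {𝓧₁ 𝓧₂ : ℕ → Type*} [∀ n, MeasurableSpace (𝓧₁ n)] [∀ n, MeasurableSpace (𝓧₂ n)]
    {𝓨₁ 𝓨₂ : Type*} [MeasurableSpace 𝓨₁] [MeasurableSpace 𝓨₂]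
    (Z₁n : ∀ n, Ω n → S₁) (X₁n : ∀ n, Ω n → 𝓧₁ n)
    (Z₂n : ∀ n, Ω n → S₂) (X₂n : ∀ n, Ω n → 𝓧₂ n)
    (Z₁ : Ω₀ → S₁) (X₁ : Ω₀ → 𝓨₁) (Z₂ : Ω₀ → S₂) (X₂ : Ω₀ → 𝓨₂) : Prop :=
  ∀ (h₁ : S₁ →ᵇ ℝ) (h₂ : S₂ →ᵇ ℝ),
    TendstoInDistribution
      (fun n ω => (condMean (P n) h₁ (Z₁n n) (X₁n n) ω, condMean (P n) h₂ (Z₂n n) (X₂n n) ω))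
      atTop
      (fun ω => (condMean P₀ h₁ Z₁ X₁ ω, condMean P₀ h₂ Z₂ X₂ ω)) P P₀

/-- Weak convergence in distribution `(Z₁ₙ | X₁ₙ, Z₂ₙ | X₂ₙ) →_w (Z₁ | X₁, Z₂ | X₂)`, jointly
with the convergence in distribution `Vₙ →_w V`. -/
def JointCondWeakConvWith {Ω : ℕ → Type*} [∀ n, MeasurableSpace (Ω n)]
    (P : ∀ n, Measure (Ω n)) [∀ n, IsProbabilityMeasure (P n)]
    {Ω₀ : Type*} [MeasurableSpace Ω₀] (P₀ : Measure Ω₀) [IsProbabilityMeasure P₀]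
    {S₁ S₂ 𝓥 : Type*} [TopologicalSpace S₁] [TopologicalSpace S₂]
    [TopologicalSpace 𝓥] [PolishSpace 𝓥] [MeasurableSpace 𝓥] [BorelSpace 𝓥]
    {𝓧₁ 𝓧₂ : ℕ → Type*} [∀ n, MeasurableSpace (𝓧₁ n)] [∀ n, MeasurableSpace (𝓧₂ n)]
    {𝓨₁ 𝓨₂ : Type*} [MeasurableSpace 𝓨₁] [MeasurableSpace 𝓨₂]
    (Z₁n : ∀ n, Ω n → S₁) (X₁n : ∀ n, Ω n → 𝓧₁ n)
    (Z₂n : ∀ n, Ω n → S₂) (X₂n : ∀ n, Ω n → 𝓧₂ n) (Vn : ∀ n, Ω n → 𝓥)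
    (Z₁ : Ω₀ → S₁) (X₁ : Ω₀ → 𝓨₁) (Z₂ : Ω₀ → S₂) (X₂ : Ω₀ → 𝓨₂) (V : Ω₀ → 𝓥) : Prop :=
  ∀ (h₁ : S₁ →ᵇ ℝ) (h₂ : S₂ →ᵇ ℝ),
    TendstoInDistribution
      (fun n ω => (condMean (P n) h₁ (Z₁n n) (X₁n n) ω,
        condMean (P n) h₂ (Z₂n n) (X₂n n) ω, Vn n ω))
      atTop
      (fun ω => (condMean P₀ h₁ Z₁ X₁ ω, condMean P₀ h₂ Z₂ X₂ ω, V ω)) P P₀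

/-- The bootstrap p-value `p* = P(τ* ≤ τ | D)`. -/
noncomputable def bootstrapPValue {Ω 𝓓 : Type*} [MeasurableSpace Ω] [MeasurableSpace 𝓓]
    (P : Measure Ω) (D : Ω → 𝓓) (τ τs : Ω → ℝ) : Ω → ℝ :=
  P⟦{ω | τs ω ≤ τ ω} | sigmaOf D⟧

/-- The bootstrap based on `τₙ` and `τₙ*`, with data `Dₙ`, is valid conditionally on `Xₙ`:
`P(pₙ* ≤ q | Xₙ) → q` in probability for all `q ∈ (0,1)`. -/
def BootstrapValidConditionally {Ω : ℕ → Type*} [∀ n, MeasurableSpace (Ω n)]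
    (P : ∀ n, Measure (Ω n)) {𝓓 𝓧 : ℕ → Type*} [∀ n, MeasurableSpace (𝓓 n)]
    [∀ n, MeasurableSpace (𝓧 n)] (D : ∀ n, Ω n → 𝓓 n) (τ τs : ∀ n, Ω n → ℝ)
    (X : ∀ n, Ω n → 𝓧 n) : Prop :=
  ∀ q ∈ Set.Ioo (0 : ℝ) 1,
    TendstoInProb P
      (fun n => (P n)⟦{ω | bootstrapPValue (P n) (D n) (τ n) (τs n) ω ≤ q} | sigmaOf (X n)⟧) q

/-- `sup_u |P(τₙ ≤ u | Xₙ) - P(τₙ* ≤ u | Dₙ)| → 0` in probability. -/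
def CondCdfsUniformlyClose {Ω : ℕ → Type*} [∀ n, MeasurableSpace (Ω n)]
    (P : ∀ n, Measure (Ω n)) [∀ n, IsProbabilityMeasure (P n)]
    {𝓓 𝓧 : ℕ → Type*} [∀ n, MeasurableSpace (𝓓 n)] [∀ n, MeasurableSpace (𝓧 n)]
    (D : ∀ n, Ω n → 𝓓 n) (τ τs : ∀ n, Ω n → ℝ) (X : ∀ n, Ω n → 𝓧 n) : Prop :=
  TendstoInProb P
    (fun n ω => ⨆ u : ℝ,
      |randomCdf (P n) (τ n) (X n) ω u - randomCdf (P n) (τs n) (D n) ω u|) 0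

/-! Let `Y n` be the conditioning variable (`Xn` in (a), `Xn'` in (b)). For bounded continuous `g`
put Uₙ(g) = E{g(τₙ) | Yₙ} and Vₙ(g) = E{g(τₙ*) | Dₙ}. Both conclusions follow from two facts, valid
for every `g`: E|Uₙ(g) - Vₙ(g)| → 0, and E Vₙ(g)² tends to the second moment of E{g(τ) | Y}, where Y
is the limit conditioning variable.

From test functions to cdfs (`eventually_exists_error`): the sigmoid maps the line into (0, 1),
which is cut into M cells. Two cdfs differ uniformly by at most finitely many differences of ramp
integrals plus the mass that one law gives to a bump around a cell. Bump masses are controlled by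
the sum of their squares, the energy. Its mean is a finite sum of second moments of conditional
means, so it passes to the limit in n; for a limit law with continuous cdf it vanishes as M → ∞. The
energy also bounds the atoms of the law of τₙ given Yₙ. Since τₙ is a function of Dₙ, the p-value is
the bootstrap cdf at τₙ, hence is close to the cdf of τₙ given Yₙ evaluated at τₙ, which is nearly
uniform given Yₙ because the atoms are small (`bootstrapValid_of_eventually_exists_error`).

The first fact is immediate in (a), where the limit of (Uₙ(g), Vₙ(g)) lies on the diagonal. In (b),
`tendsto_integral_abs_condMean_sub_of_coarser` approximates E{g(τ) | X', X''} in L² by a sum φ of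
products a(X')b(X''), and E{φ | X'} by a continuous Φ(X'). Joint convergence carries the
approximations by φ and Φ to large n. Convergence of Xₙ'' | Xₙ' does the same for the approximation
of E{φ(Xₙ', Xₙ'') | Xₙ'} by Φ(Xₙ'). -/

/-! ### Ramps and bumps on the sigmoid scale. -/

/-- The decreasing ramp `x ↦ i - M * sigmoid x`, truncated to `[0, 1]`. -/
noncomputable def sigmoidRamp (M i : ℕ) : ℝ →ᵇ ℝ :=
  BoundedContinuousFunction.ofNormedAddCommGroup
    (fun x => max 0 (min 1 ((i : ℝ) - M * x.sigmoid))) (by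
      have := continuous_sigmoid
      fun_prop) 1 (fun x => by
      rw [Real.norm_eq_abs, abs_of_nonneg (le_max_left _ _)]
      exact max_le zero_le_one (min_le_left _ _))

/-- The difference of two ramps at distance two; it is `1` at points `x` with
`i ≤ M * sigmoid x ≤ i + 1`. -/
noncomputable def sigmoidBump (M i : ℕ) : ℝ →ᵇ ℝ := sigmoidRamp M (i + 2) - sigmoidRamp M i

lemma sigmoidRamp_apply (M i : ℕ) (x : ℝ) :
    sigmoidRamp M i x = max 0 (min 1 ((i : ℝ) - M * x.sigmoid)) := rfl

lemma sigmoidBump_apply (M i : ℕ) (x : ℝ) :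
    sigmoidBump M i x = sigmoidRamp M (i + 2) x - sigmoidRamp M i x := rfl

lemma sigmoidRamp_nonneg (M i : ℕ) (x : ℝ) : 0 ≤ sigmoidRamp M i x := le_max_left _ _

lemma sigmoidRamp_le_one (M i : ℕ) (x : ℝ) : sigmoidRamp M i x ≤ 1 :=
  max_le zero_le_one (min_le_left _ _)

lemma sigmoidRamp_mono (M : ℕ) {i j : ℕ} (h : i ≤ j) (x : ℝ) :
    sigmoidRamp M i x ≤ sigmoidRamp M j x := by
  have : (i : ℝ) ≤ j := by exact_mod_cast h
  exact max_le_max le_rfl (min_le_min le_rfl (by linarith))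

lemma sigmoidRamp_eq_zero {M i : ℕ} {x : ℝ} (h : (i : ℝ) ≤ M * x.sigmoid) :
    sigmoidRamp M i x = 0 :=
  max_eq_left ((min_le_right _ _).trans (by linarith))

lemma sigmoidRamp_eq_one {M i : ℕ} {x : ℝ} (h : M * x.sigmoid + 1 ≤ i) :
    sigmoidRamp M i x = 1 := by
  rw [sigmoidRamp_apply, min_eq_left (by linarith), max_eq_right zero_le_one]

lemma sigmoidBump_nonneg (M i : ℕ) (x : ℝ) : 0 ≤ sigmoidBump M i x :=
  sub_nonneg.2 (sigmoidRamp_mono M (by omega) x)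

lemma sigmoidBump_le_one (M i : ℕ) (x : ℝ) : sigmoidBump M i x ≤ 1 := by
  rw [sigmoidBump_apply]
  linarith [sigmoidRamp_le_one M (i + 2) x, sigmoidRamp_nonneg M i x]

/-- The sum telescopes with step two, leaving two ramps at each end. -/
lemma sum_sigmoidBump_le_two (M : ℕ) (x : ℝ) :
    ∑ i ∈ Finset.range M, sigmoidBump M i x ≤ 2 := by
  have h : ∀ N : ℕ, ∑ i ∈ Finset.range N, sigmoidBump M i x =
      sigmoidRamp M (N + 1) x + sigmoidRamp M N x - sigmoidRamp M 1 x - sigmoidRamp M 0 x := by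
    intro N
    induction N with
    | zero => simp
    | succ N ih => rw [Finset.sum_range_succ, ih, sigmoidBump_apply]; ring
  rw [h]
  linarith [sigmoidRamp_le_one M (M + 1) x, sigmoidRamp_le_one M M x,
    sigmoidRamp_nonneg M 1 x, sigmoidRamp_nonneg M 0 x]

/-- On the sigmoid scale multiplied by `M`, a bump lives on an interval of length three. -/
lemma sigmoidBump_mul_eq_zero {M : ℕ} (i : ℕ) {x y : ℝ} (h : 3 ≤ M * |x.sigmoid - y.sigmoid|) :
    sigmoidBump M i x * sigmoidBump M i y = 0 := by
  have key : ∀ z : ℝ, sigmoidBump M i z ≠ 0 → (i : ℝ) - 1 < M * z.sigmoid ∧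
      M * z.sigmoid < i + 2 := by
    intro z hz
    constructor
    · by_contra! hc
      exact hz (by
        rw [sigmoidBump_apply, sigmoidRamp_eq_one (by push_cast; linarith),
          sigmoidRamp_eq_one (by linarith), sub_self])
    · by_contra! hc
      exact hz (by
        rw [sigmoidBump_apply, sigmoidRamp_eq_zero (by push_cast; linarith),
          sigmoidRamp_eq_zero (by linarith), sub_self])
  by_contra hne
  obtain ⟨hx, hy⟩ := mul_ne_zero_iff.1 hne
  obtain ⟨h1, h2⟩ := key x hx
  obtain ⟨h3, h4⟩ := key y hy
  have : |(M : ℝ) * x.sigmoid - M * y.sigmoid| < 3 := abs_lt.2 ⟨by linarith, by linarith⟩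
  rw [← mul_sub, abs_mul, Nat.abs_cast] at this
  linarith

/-! ### Energy of a law, and its decay for atomless laws. -/

/-- The sum of the squared masses that a measure gives to the bumps. -/
noncomputable def bumpEnergy (M : ℕ) (κ : Measure ℝ) : ℝ :=
  ∑ i ∈ Finset.range M, (∫ x, sigmoidBump M i x ∂κ) ^ 2

lemma bumpEnergy_nonneg (M : ℕ) (κ : Measure ℝ) : 0 ≤ bumpEnergy M κ :=
  Finset.sum_nonneg fun _ _ => sq_nonneg _

lemma bumpEnergy_eq_integral_prod (M : ℕ) (κ : Measure ℝ) [IsProbabilityMeasure κ] :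
    bumpEnergy M κ =
      ∫ p, ∑ i ∈ Finset.range M, sigmoidBump M i p.1 * sigmoidBump M i p.2 ∂(κ.prod κ) := by
  rw [integral_finsetSum]
  · exact Finset.sum_congr rfl fun i _ => by rw [integral_prod_mul, sq]
  · intro i _
    exact ((sigmoidBump M i).integrable κ).mul_prod ((sigmoidBump M i).integrable κ)

lemma sum_sigmoidBump_mul_nonneg (M : ℕ) (x y : ℝ) :
    0 ≤ ∑ i ∈ Finset.range M, sigmoidBump M i x * sigmoidBump M i y :=
  Finset.sum_nonneg fun i _ => mul_nonneg (sigmoidBump_nonneg M i x) (sigmoidBump_nonneg M i y)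

lemma sum_sigmoidBump_mul_le_two (M : ℕ) (x y : ℝ) :
    ∑ i ∈ Finset.range M, sigmoidBump M i x * sigmoidBump M i y ≤ 2 :=
  (Finset.sum_le_sum fun i _ => mul_le_of_le_one_right (sigmoidBump_nonneg M i x)
    (sigmoidBump_le_one M i y)).trans (sum_sigmoidBump_le_two M x)

lemma bumpEnergy_le_two (M : ℕ) (κ : Measure ℝ) [IsProbabilityMeasure κ] :
    bumpEnergy M κ ≤ 2 := by
  rw [bumpEnergy_eq_integral_prod]
  refine (integral_mono_of_nonneg (g := fun _ => (2 : ℝ)) ?_ (integrable_const _) ?_).trans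
    (by simp)
  · exact Eventually.of_forall fun p => sum_sigmoidBump_mul_nonneg M p.1 p.2
  · exact Eventually.of_forall fun p => sum_sigmoidBump_mul_le_two M p.1 p.2

lemma ae_prod_fst_ne_snd (κ : Measure ℝ) [SFinite κ] [NullSingletonClass κ] :
    ∀ᵐ p ∂(κ.prod κ), p.1 ≠ p.2 := by
  have hs : MeasurableSet {p : ℝ × ℝ | p.1 ≠ p.2} :=
    (measurableSet_eq_fun measurable_fst measurable_snd).compl
  refine (Measure.ae_prod_iff_ae_ae hs).2 (Eventually.of_forall fun x => ?_)
  filter_upwards [Measure.ae_ne κ x] with y hy using hy.symm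

/-- By Fubini the energy is a `κ.prod κ`-integral of a kernel bounded by 2 that eventually vanishes
at each point off the diagonal. The diagonal is null because `κ` has no atoms. -/
lemma tendsto_bumpEnergy (κ : Measure ℝ) [IsProbabilityMeasure κ] [NullSingletonClass κ] :
    Tendsto (fun M => bumpEnergy M κ) atTop (𝓝 0) := by
  simp_rw [bumpEnergy_eq_integral_prod]
  rw [← integral_zero (ℝ × ℝ) ℝ (μ := κ.prod κ)]
  refine tendsto_integral_of_dominated_convergence (fun _ => (2 : ℝ)) ?_ (integrable_const _) ?_ ?_
  · intro M
    refine Continuous.aestronglyMeasurable ?_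
    fun_prop
  · intro M
    filter_upwards with p
    rw [Real.norm_eq_abs, abs_of_nonneg (sum_sigmoidBump_mul_nonneg M _ _)]
    exact sum_sigmoidBump_mul_le_two M _ _
  · filter_upwards [ae_prod_fst_ne_snd κ] with p hp
    have hpos : 0 < |p.1.sigmoid - p.2.sigmoid| :=
      abs_pos.2 (sub_ne_zero.2 fun h => hp (Real.sigmoid_injective h))
    refine tendsto_const_nhds.congr' ?_
    filter_upwards [(tendsto_natCast_atTop_atTop.atTop_mul_const hpos).eventually_ge_atTop 3]
      with M hM
    exact (Finset.sum_eq_zero fun i _ => sigmoidBump_mul_eq_zero i hM).symm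

lemma nullSingletonClass_of_continuous_measureReal_Iic {κ : Measure ℝ} [IsProbabilityMeasure κ]
    (h : Continuous fun u => κ.real (Set.Iic u)) : NullSingletonClass κ := by
  refine ⟨fun x => ?_⟩
  have h1 : ⇑(cdf κ) = fun u => κ.real (Set.Iic u) := by
    ext u; exact cdf_eq_real κ u
  have h2 : (cdf κ).measure {x} = ENNReal.ofReal (cdf κ x - Function.leftLim (cdf κ) x) :=
    StieltjesFunction.measure_singleton _ x
  rw [measure_cdf] at h2
  have h3 : Continuous (cdf κ) := by rwa [h1]
  rw [h2, h3.continuousWithinAt.leftLim_eq, sub_self, ENNReal.ofReal_zero]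

/-! ### Cdf distance and atoms bounded by finitely many test integrals. -/

/-- An index `i < M` with `i ≤ M * sigmoid u < i + 1`. -/
lemma exists_index_sigmoid {M : ℕ} (hM : 0 < M) (u : ℝ) :
    ∃ i < M, (i : ℝ) ≤ M * u.sigmoid ∧ M * u.sigmoid ≤ i + 1 := by
  have hM' : (0 : ℝ) < M := by exact_mod_cast hM
  have h0 : 0 ≤ M * u.sigmoid := mul_nonneg hM'.le u.sigmoid_nonneg
  refine ⟨⌊M * u.sigmoid⌋₊, ?_, Nat.floor_le h0, (Nat.lt_floor_add_one _).le⟩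
  rw [Nat.floor_lt h0]
  nlinarith [u.sigmoid_lt_one]

lemma integral_sigmoidRamp_le {M i : ℕ} {u : ℝ} (κ : Measure ℝ) [IsProbabilityMeasure κ]
    (h : (i : ℝ) ≤ M * u.sigmoid) : ∫ x, sigmoidRamp M i x ∂κ ≤ κ.real (Set.Iic u) := by
  rw [← integral_indicator_one measurableSet_Iic]
  refine integral_mono ((sigmoidRamp M i).integrable κ)
    ((integrable_const (1 : ℝ)).indicator measurableSet_Iic) fun x => ?_
  by_cases hx : x ≤ u
  · simpa [Set.indicator, hx] using sigmoidRamp_le_one M i x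
  · have : (i : ℝ) ≤ M * x.sigmoid :=
      h.trans (mul_le_mul_of_nonneg_left (Real.sigmoid_le (not_le.1 hx).le) (Nat.cast_nonneg _))
    simp [Set.indicator, hx, sigmoidRamp_eq_zero this]

lemma le_integral_sigmoidRamp {M i : ℕ} {u : ℝ} (κ : Measure ℝ) [IsProbabilityMeasure κ]
    (h : M * u.sigmoid + 1 ≤ i) : κ.real (Set.Iic u) ≤ ∫ x, sigmoidRamp M i x ∂κ := by
  rw [← integral_indicator_one measurableSet_Iic]
  refine integral_mono ((integrable_const (1 : ℝ)).indicator measurableSet_Iic)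
    ((sigmoidRamp M i).integrable κ) fun x => ?_
  by_cases hx : x ≤ u
  · have : M * x.sigmoid + 1 ≤ i := le_trans (add_le_add_left
      (mul_le_mul_of_nonneg_left (Real.sigmoid_le hx) (Nat.cast_nonneg _)) _) h
    simp [Set.indicator, hx, sigmoidRamp_eq_one this]
  · simpa [Set.indicator, hx] using sigmoidRamp_nonneg M i x

lemma integral_sigmoidBump (M i : ℕ) (κ : Measure ℝ) [IsProbabilityMeasure κ] :
    ∫ x, sigmoidBump M i x ∂κ = ∫ x, sigmoidRamp M (i + 2) x ∂κ - ∫ x, sigmoidRamp M i x ∂κ :=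
  integral_sub ((sigmoidRamp M (i + 2)).integrable κ) ((sigmoidRamp M i).integrable κ)

/-- Any real m satisfies m ≤ δ + m²/δ, and m² is one term of the energy. -/
lemma integral_sigmoidBump_le {M i : ℕ} (hi : i < M) (κ : Measure ℝ) {δ : ℝ} (hδ : 0 < δ) :
    ∫ x, sigmoidBump M i x ∂κ ≤ δ + bumpEnergy M κ / δ := by
  have h1 : (∫ x, sigmoidBump M i x ∂κ) ^ 2 ≤ bumpEnergy M κ :=
    Finset.single_le_sum (f := fun i => (∫ x, sigmoidBump M i x ∂κ) ^ 2)
      (fun _ _ => sq_nonneg _) (Finset.mem_range.2 hi)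
  rw [← sub_le_iff_le_add', le_div_iff₀ hδ]
  nlinarith [sq_nonneg ((∫ x, sigmoidBump M i x ∂κ) - δ)]

/-- Both cdfs at `u` lie between the integrals of ramps `i` and `i + 2`, whose difference is bump
`i`. Only the energy of `κ'` enters, since the ramp integrals of `κ` are compared with those of
`κ'`. -/
lemma abs_measureReal_Iic_sub_le {M : ℕ} (hM : 0 < M) (κ κ' : Measure ℝ)
    [IsProbabilityMeasure κ] [IsProbabilityMeasure κ'] {δ : ℝ} (hδ : 0 < δ) (u : ℝ) :
    |κ.real (Set.Iic u) - κ'.real (Set.Iic u)| ≤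
      ∑ i ∈ Finset.range (M + 2), |∫ x, sigmoidRamp M i x ∂κ - ∫ x, sigmoidRamp M i x ∂κ'| +
        (δ + bumpEnergy M κ' / δ) := by
  obtain ⟨i, hi, h1, h2⟩ := exists_index_sigmoid hM u
  have h2' : M * u.sigmoid + 1 ≤ ((i + 2 : ℕ) : ℝ) := by push_cast; linarith
  have hs : ∀ j < M + 2, |∫ x, sigmoidRamp M j x ∂κ - ∫ x, sigmoidRamp M j x ∂κ'| ≤
      ∑ i ∈ Finset.range (M + 2), |∫ x, sigmoidRamp M i x ∂κ - ∫ x, sigmoidRamp M i x ∂κ'| :=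
    fun j hj => Finset.single_le_sum
      (f := fun i => |∫ x, sigmoidRamp M i x ∂κ - ∫ x, sigmoidRamp M i x ∂κ'|)
      (fun _ _ => abs_nonneg _) (Finset.mem_range.2 hj)
  have ha := (le_abs_self _).trans (hs (i + 2) (by omega))
  have hb := (neg_abs_le (∫ x, sigmoidRamp M i x ∂κ - ∫ x, sigmoidRamp M i x ∂κ'))
  have hb' := hs i (by omega)
  have hc := integral_sigmoidBump_le hi κ' hδ
  rw [integral_sigmoidBump] at hc
  have := integral_sigmoidRamp_le κ h1
  have := integral_sigmoidRamp_le κ' h1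
  have := le_integral_sigmoidRamp κ h2'
  have := le_integral_sigmoidRamp κ' h2'
  exact abs_le.2 ⟨by linarith, by linarith⟩

lemma measureReal_singleton_le {M : ℕ} (hM : 0 < M) (κ : Measure ℝ) [IsProbabilityMeasure κ]
    {δ : ℝ} (hδ : 0 < δ) (u : ℝ) : κ.real {u} ≤ δ + bumpEnergy M κ / δ := by
  obtain ⟨i, hi, h1, h2⟩ := exists_index_sigmoid hM u
  refine le_trans ?_ (integral_sigmoidBump_le hi κ hδ)
  rw [← integral_indicator_one (measurableSet_singleton u)]
  refine integral_mono ((integrable_const (1 : ℝ)).indicator (measurableSet_singleton u))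
    ((sigmoidBump M i).integrable κ) fun x => ?_
  by_cases hx : x = u
  · subst hx
    rw [sigmoidBump_apply, sigmoidRamp_eq_one (by push_cast; linarith), sigmoidRamp_eq_zero h1]
    simp
  · simpa [Set.indicator, hx] using sigmoidBump_nonneg M i x

/-! ### Probability integral transform in the presence of atoms. -/

/-- The probability integral transform: a cdf evaluated at a random variable with that cdf is
uniform, up to the size of the atoms. -/
lemma measureReal_cdf_le_mem_Icc (κ : Measure ℝ) [IsProbabilityMeasure κ] {q a : ℝ}
    (hq0 : 0 < q) (hq1 : q < 1) (ha : ∀ x, κ.real {x} ≤ a) :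
    κ.real {x | κ.real (Set.Iic x) ≤ q} ∈ Set.Icc (q - a) q := by
  set S := {x | κ.real (Set.Iic x) ≤ q} with hS
  have hF : (fun x => κ.real (Set.Iic x)) = cdf κ := by ext u; exact (cdf_eq_real κ u).symm
  have hmono : Monotone fun x => κ.real (Set.Iic x) := by rw [hF]; exact monotone_cdf κ
  have hne : S.Nonempty := by
    have := (tendsto_cdf_atBot κ).eventually_lt_const hq0
    rw [← hF] at this
    obtain ⟨x, hx⟩ := this.exists
    exact ⟨x, hx.le⟩
  have hbdd : BddAbove S := by
    have := (tendsto_cdf_atTop κ).eventually_const_lt hq1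
    rw [← hF] at this
    obtain ⟨x, hx⟩ := this.exists
    refine ⟨x, fun y hy => ?_⟩
    by_contra! hlt
    exact absurd (hmono hlt.le) (not_le.2 (lt_of_le_of_lt hy hx))
  -- `S` is a lower half-line with endpoint `s`. Right continuity makes the cdf at least `q` at `s`,
  -- so removing the atom at `s` gives the lower bound.
  set s := sSup S
  have hIio : Set.Iio s ⊆ S := fun x hx => by
    obtain ⟨y, hy, hxy⟩ := exists_lt_of_lt_csSup hne hx
    exact (hmono hxy.le).trans hy
  have hIic : S ⊆ Set.Iic s := fun x hx => le_csSup hbdd hx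
  have hge : q ≤ κ.real (Set.Iic s) := by
    have hrc : Tendsto (cdf κ) (𝓝[>] s) (𝓝 (cdf κ s)) :=
      ((cdf κ).right_continuous s).mono_left (nhdsWithin_mono _ Set.Ioi_subset_Ici_self)
    rw [← cdf_eq_real]
    refine ge_of_tendsto hrc ?_
    filter_upwards [self_mem_nhdsWithin] with x hx
    rw [cdf_eq_real]
    by_contra! hlt
    have hxs : x ≤ s := hIic (show x ∈ S from hlt.le)
    exact not_le.2 (Set.mem_Ioi.1 hx) hxs
  constructor
  · have h1 : κ.real (Set.Iic s) ≤ κ.real (Set.Iio s) + κ.real {s} := by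
      rw [← Set.Iio_union_right]; exact measureReal_union_le _ _
    linarith [measureReal_mono (μ := κ) hIio, ha s]
  · by_cases hs : s ∈ S
    · exact (measureReal_mono hIic).trans hs
    -- When `s` is not attained, the bound `q` at points below `s` passes to `Set.Iio s` by
    -- continuity from below.
    · have hsub : S ⊆ Set.Iio s := fun x hx =>
        lt_of_le_of_ne (hIic hx) (ne_of_mem_of_not_mem hx hs)
      refine (measureReal_mono hsub).trans ?_
      rw [measureReal_def]
      refine ENNReal.toReal_le_of_le_ofReal hq0.le ?_
      obtain ⟨v, hv, hvlt, hvt⟩ := exists_seq_strictMono_tendsto s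
      have hU : Set.Iio s = ⋃ n, Set.Iic (v n) := by
        ext x
        simp only [Set.mem_Iio, Set.mem_iUnion, Set.mem_Iic]
        exact ⟨fun hx => ((hvt.eventually_const_lt hx).exists).imp fun _ h => h.le,
          fun ⟨n, hn⟩ => hn.trans_lt (hvlt n)⟩
      rw [hU, Monotone.measure_iUnion (fun m n hmn => Set.Iic_subset_Iic.2 (hv.monotone hmn))]
      refine iSup_le fun n => ?_
      rw [ENNReal.le_ofReal_iff_toReal_le (measure_ne_top _ _) hq0.le]
      exact hIio (hvlt n)

/-! ### Conditional means and regular conditional distributions. -/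

section CondMean

variable {Ω S 𝓧 : Type*} [MeasurableSpace Ω] [TopologicalSpace S] [MeasurableSpace 𝓧]
  {P : Measure Ω}

lemma integrable_condMean (h : S →ᵇ ℝ) (Z : Ω → S) (X : Ω → 𝓧) :
    Integrable (condMean P h Z X) P := integrable_condExp

lemma abs_condMean_le (h : S →ᵇ ℝ) (Z : Ω → S) (X : Ω → 𝓧) :
    ∀ᵐ ω ∂P, |condMean P h Z X ω| ≤ ‖h‖ :=
  ae_bdd_abs_condExp_of_ae_bdd_abs (R := ‖h‖) (Eventually.of_forall fun ω => h.norm_coe_le_norm (Z ω))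

lemma integrable_comp_boundedContinuous [MeasurableSpace S] [OpensMeasurableSpace S]
    [IsFiniteMeasure P] (h : S →ᵇ ℝ) {Z : Ω → S} (hZ : Measurable Z) :
    Integrable (fun ω => h (Z ω)) P :=
  Integrable.of_bound ((h.continuous.measurable.comp hZ).aestronglyMeasurable) ‖h‖
    (Eventually.of_forall fun ω => h.norm_coe_le_norm (Z ω))

lemma integrable_condMean_sq [IsFiniteMeasure P] (h : S →ᵇ ℝ) (Z : Ω → S) (X : Ω → 𝓧) :
    Integrable (fun ω => condMean P h Z X ω ^ 2) P := by
  refine Integrable.of_bound ((integrable_condMean h Z X).1.pow 2) (‖h‖ ^ 2) ?_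
  filter_upwards [abs_condMean_le (P := P) h Z X] with ω hω
  rw [norm_pow, Real.norm_eq_abs]
  gcongr

end CondMean

section Kernel

variable {Ω 𝓧 : Type*} [MeasurableSpace Ω] [MeasurableSpace 𝓧]
  {P : Measure Ω} {Z : Ω → ℝ} {X : Ω → 𝓧}

/-- The sum of the squared conditional expectations of the bumps. -/
noncomputable def condBumpEnergy (P : Measure Ω) (Z : Ω → ℝ) (X : Ω → 𝓧) (M : ℕ) (ω : Ω) : ℝ :=
  ∑ i ∈ Finset.range M, condMean P (sigmoidBump M i) Z X ω ^ 2

lemma condBumpEnergy_nonneg (M : ℕ) (ω : Ω) : 0 ≤ condBumpEnergy P Z X M ω :=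
  Finset.sum_nonneg fun _ _ => sq_nonneg _

variable [IsProbabilityMeasure P]

lemma condMean_ae_eq_integral_condDistrib (g : ℝ →ᵇ ℝ) (hZ : Measurable Z) (hX : Measurable X) :
    condMean P g Z X =ᵐ[P] fun ω => ∫ x, g x ∂condDistrib Z X P (X ω) :=
  condExp_ae_eq_integral_condDistrib hX hZ.aemeasurable
    g.continuous.measurable.stronglyMeasurable (integrable_comp_boundedContinuous g hZ)

lemma integrable_condBumpEnergy (M : ℕ) : Integrable (condBumpEnergy P Z X M) P :=
  integrable_finsetSum _ fun _ _ => integrable_condMean_sq _ _ _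

lemma integral_condBumpEnergy (M : ℕ) : ∫ ω, condBumpEnergy P Z X M ω ∂P =
    ∑ i ∈ Finset.range M, ∫ ω, condMean P (sigmoidBump M i) Z X ω ^ 2 ∂P :=
  integral_finsetSum _ fun _ _ => integrable_condMean_sq _ _ _

lemma condBumpEnergy_ae_eq (hZ : Measurable Z) (hX : Measurable X) (M : ℕ) :
    ∀ᵐ ω ∂P, condBumpEnergy P Z X M ω = bumpEnergy M (condDistrib Z X P (X ω)) := by
  have : ∀ᵐ ω ∂P, ∀ i, condMean P (sigmoidBump M i) Z X ω =
      ∫ x, sigmoidBump M i x ∂condDistrib Z X P (X ω) :=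
    ae_all_iff.2 fun i => condMean_ae_eq_integral_condDistrib _ hZ hX
  filter_upwards [this] with ω hω
  simp only [condBumpEnergy, bumpEnergy, hω]

lemma tendsto_integral_condBumpEnergy (hZ : Measurable Z) (hX : Measurable X)
    (hc : SamplePathContinuousCdf P Z X) :
    Tendsto (fun M => ∫ ω, condBumpEnergy P Z X M ω ∂P) atTop (𝓝 0) := by
  rw [← integral_zero Ω ℝ (μ := P)]
  have hae : ∀ᵐ ω ∂P, ∀ M, condBumpEnergy P Z X M ω = bumpEnergy M (condDistrib Z X P (X ω)) :=
    ae_all_iff.2 fun M => condBumpEnergy_ae_eq hZ hX M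
  refine tendsto_integral_of_dominated_convergence (fun _ => (2 : ℝ))
    (fun M => (integrable_condBumpEnergy M).1) (integrable_const _) ?_ ?_
  · intro M
    filter_upwards [hae] with ω hω
    rw [hω, Real.norm_eq_abs, abs_of_nonneg (bumpEnergy_nonneg _ _)]
    exact bumpEnergy_le_two _ _
  · filter_upwards [hae, hc] with ω hω hcω
    simp_rw [hω]
    have := nullSingletonClass_of_continuous_measureReal_Iic hcω
    exact tendsto_bumpEnergy _

lemma abs_randomCdf_sub_le {𝓓 : Type*} [MeasurableSpace 𝓓] {Z' : Ω → ℝ} {D : Ω → 𝓓}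
    (hZ : Measurable Z) (hX : Measurable X) (hZ' : Measurable Z') (hD : Measurable D)
    {M : ℕ} (hM : 0 < M) {δ : ℝ} (hδ : 0 < δ) :
    ∀ᵐ ω ∂P, ∀ u, |randomCdf P Z X ω u - randomCdf P Z' D ω u| ≤
      ∑ i ∈ Finset.range (M + 2),
        |condMean P (sigmoidRamp M i) Z X ω - condMean P (sigmoidRamp M i) Z' D ω| +
        (δ + condBumpEnergy P Z' D M ω / δ) := by
  have h1 : ∀ᵐ ω ∂P, ∀ i, condMean P (sigmoidRamp M i) Z X ω =
      ∫ x, sigmoidRamp M i x ∂condDistrib Z X P (X ω) :=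
    ae_all_iff.2 fun i => condMean_ae_eq_integral_condDistrib _ hZ hX
  have h2 : ∀ᵐ ω ∂P, ∀ i, condMean P (sigmoidRamp M i) Z' D ω =
      ∫ x, sigmoidRamp M i x ∂condDistrib Z' D P (D ω) :=
    ae_all_iff.2 fun i => condMean_ae_eq_integral_condDistrib _ hZ' hD
  filter_upwards [h1, h2, condBumpEnergy_ae_eq hZ' hD M] with ω h1 h2 h3 u
  simp only [h1, h2, h3]
  exact abs_measureReal_Iic_sub_le hM _ _ hδ u

lemma condDistrib_singleton_le (hZ : Measurable Z) (hX : Measurable X) {M : ℕ} (hM : 0 < M)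
    {δ : ℝ} (hδ : 0 < δ) :
    ∀ᵐ ω ∂P, ∀ u, (condDistrib Z X P (X ω)).real {u} ≤ δ + condBumpEnergy P Z X M ω / δ := by
  filter_upwards [condBumpEnergy_ae_eq hZ hX M] with ω h3 u
  rw [h3]
  exact measureReal_singleton_le hM _ hδ u

/-- Joint measurability makes a level set of the random cdf, evaluated at the variable itself, an
event in the pair of conditioning variable and variable. -/
lemma measurable_condDistrib_Iic : Measurable fun p : 𝓧 × ℝ =>
    (condDistrib Z X P p.1).real (Set.Iic p.2) := by
  have hs : MeasurableSet {q : (𝓧 × ℝ) × ℝ | q.2 ≤ q.1.2} :=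
    measurableSet_le measurable_snd (measurable_snd.comp measurable_fst)
  have := Kernel.measurable_kernel_prodMk_left
    (κ := (condDistrib Z X P).comap (Prod.fst : 𝓧 × ℝ → 𝓧) measurable_fst) hs
  exact this.ennreal_toReal

/-- The conditional probability, given `X`, of an event that depends on `X` and `Z`. -/
lemma condExp_indicator_ae_eq_condDistrib (hZ : Measurable Z) (hX : Measurable X)
    {s : Set (𝓧 × ℝ)} (hs : MeasurableSet s) :
    P⟦{ω | (X ω, Z ω) ∈ s} | sigmaOf X⟧ =ᵐ[P]
      fun ω => (condDistrib Z X P (X ω)).real {x | (X ω, x) ∈ s} := by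
  have h := condExp_prod_ae_eq_integral_condDistrib (μ := P) hX hZ.aemeasurable
    (f := s.indicator fun _ => (1 : ℝ)) (stronglyMeasurable_const.indicator hs)
    (((integrable_const (1 : ℝ)).indicator ((hX.prodMk hZ) hs)))
  refine h.trans (Eventually.of_forall fun ω => ?_)
  exact integral_indicator_one (measurable_prodMk_left hs)

/-- Given `D`, the value of `τ` is frozen, so only `τs` is averaged. -/
lemma bootstrapPValue_ae_eq {𝓓 : Type*} [MeasurableSpace 𝓓] {τ τs : Ω → ℝ} {D : Ω → 𝓓}
    {T : 𝓓 → ℝ} (hT : Measurable T) (hτ : ∀ ω, τ ω = T (D ω)) (hτs : Measurable τs)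
    (hD : Measurable D) :
    bootstrapPValue P D τ τs =ᵐ[P] fun ω => randomCdf P τs D ω (τ ω) := by
  have h := condExp_indicator_ae_eq_condDistrib (P := P) hτs hD
    (s := {p | p.2 ≤ T p.1}) (measurableSet_le measurable_snd (hT.comp measurable_fst))
  simp only [Set.mem_ofPred_eq, ← hτ] at h
  exact h

end Kernel

/-! ### From test functions to uniform control of the conditional cdfs. -/

section Control

variable {Ω : ℕ → Type*} [∀ n, MeasurableSpace (Ω n)] {P : ∀ n, Measure (Ω n)}
  [∀ n, IsProbabilityMeasure (P n)] {𝓓 𝓨 : ℕ → Type*} [∀ n, MeasurableSpace (𝓓 n)]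
  [∀ n, MeasurableSpace (𝓨 n)] {D : ∀ n, Ω n → 𝓓 n} {τ τs : ∀ n, Ω n → ℝ} {Y : ∀ n, Ω n → 𝓨 n}
  {Ω₀ : Type*} [MeasurableSpace Ω₀] {P₀ : Measure Ω₀} [IsProbabilityMeasure P₀]
  {τ₀ : Ω₀ → ℝ} {𝓨₀ : Type*} [MeasurableSpace 𝓨₀] {Y₀ : Ω₀ → 𝓨₀}

/-- Difference of squares: the factor that is a sum is at most `2 * ‖g‖`. This transfers the energy
bound from the bootstrap law to the law of `τ n` given `Y n`. -/
lemma tendsto_integral_condMean_sq_of_sub {g : ℝ →ᵇ ℝ} {c : ℝ}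
    (H₁ : Tendsto (fun n => ∫ ω, |condMean (P n) g (τ n) (Y n) ω -
      condMean (P n) g (τs n) (D n) ω| ∂P n) atTop (𝓝 0))
    (H₂ : Tendsto (fun n => ∫ ω, condMean (P n) g (τs n) (D n) ω ^ 2 ∂P n) atTop (𝓝 c)) :
    Tendsto (fun n => ∫ ω, condMean (P n) g (τ n) (Y n) ω ^ 2 ∂P n) atTop (𝓝 c) := by
  have h : Tendsto (fun n => ∫ ω, condMean (P n) g (τ n) (Y n) ω ^ 2 ∂P n -
      ∫ ω, condMean (P n) g (τs n) (D n) ω ^ 2 ∂P n) atTop (𝓝 0) := by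
    have H₁' := H₁.const_mul (2 * ‖g‖)
    rw [mul_zero] at H₁'
    refine squeeze_zero_norm (fun n => ?_) H₁'
    rw [← integral_sub (integrable_condMean_sq _ _ _) (integrable_condMean_sq _ _ _),
      ← integral_const_mul]
    refine (norm_integral_le_integral_norm _).trans (integral_mono_ae ?_ ?_ ?_)
    · exact ((integrable_condMean_sq _ _ _).sub (integrable_condMean_sq _ _ _)).norm
    · exact (((integrable_condMean _ _ _).sub (integrable_condMean _ _ _)).abs).const_mul _
    · filter_upwards [abs_condMean_le (P := P n) g (τ n) (Y n),
        abs_condMean_le (P := P n) g (τs n) (D n)] with ω h1 h2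
      rw [Real.norm_eq_abs, sq_sub_sq, abs_mul]
      refine mul_le_mul_of_nonneg_right ((abs_add_le _ _).trans (by linarith)) (abs_nonneg _)
  simpa using h.add H₂

/-- The conditional cdfs are uniformly close, and the atoms of the first one are small, up to an
error that is small in mean. -/
lemma eventually_exists_error (hτ : ∀ n, Measurable (τ n)) (hτs : ∀ n, Measurable (τs n))
    (hD : ∀ n, Measurable (D n)) (hY : ∀ n, Measurable (Y n)) (hτ₀ : Measurable τ₀)
    (hY₀ : Measurable Y₀) (hc : SamplePathContinuousCdf P₀ τ₀ Y₀)
    (H₁ : ∀ g : ℝ →ᵇ ℝ, Tendsto (fun n => ∫ ω, |condMean (P n) g (τ n) (Y n) ω -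
      condMean (P n) g (τs n) (D n) ω| ∂P n) atTop (𝓝 0))
    (H₂ : ∀ g : ℝ →ᵇ ℝ, Tendsto (fun n => ∫ ω, condMean (P n) g (τs n) (D n) ω ^ 2 ∂P n) atTop
      (𝓝 (∫ ω, condMean P₀ g τ₀ Y₀ ω ^ 2 ∂P₀))) {η : ℝ} (hη : 0 < η) :
    ∀ᶠ n in atTop, ∃ R : Ω n → ℝ, Integrable R (P n) ∧ (∀ ω, 0 ≤ R ω) ∧ ∫ ω, R ω ∂P n ≤ η ∧
      (∀ᵐ ω ∂P n, ∀ u,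
        |randomCdf (P n) (τ n) (Y n) ω u - randomCdf (P n) (τs n) (D n) ω u| ≤ η + R ω) ∧
      ∀ᵐ ω ∂P n, ∀ u, (condDistrib (τ n) (Y n) (P n) (Y n ω)).real {u} ≤ η + R ω := by
  -- With this bound the two energies divided by `η` contribute at most `η / 2` in mean; the ramp
  -- differences contribute the other half.
  obtain ⟨M, hM0, hM⟩ : ∃ M : ℕ, 0 < M ∧ ∫ ω, condBumpEnergy P₀ τ₀ Y₀ M ω ∂P₀ < η ^ 2 / 4 :=
    ((eventually_gt_atTop 0).and ((tendsto_integral_condBumpEnergy hτ₀ hY₀ hc).eventually_lt_const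
      (by positivity))).exists
  have t1 : Tendsto (fun n => ∫ ω, condBumpEnergy (P n) (τs n) (D n) M ω ∂P n) atTop
      (𝓝 (∫ ω, condBumpEnergy P₀ τ₀ Y₀ M ω ∂P₀)) := by
    simp_rw [integral_condBumpEnergy]
    exact tendsto_finsetSum _ fun i _ => H₂ _
  have t2 : Tendsto (fun n => ∫ ω, condBumpEnergy (P n) (τ n) (Y n) M ω ∂P n) atTop
      (𝓝 (∫ ω, condBumpEnergy P₀ τ₀ Y₀ M ω ∂P₀)) := by
    simp_rw [integral_condBumpEnergy]
    exact tendsto_finsetSum _ fun i _ => tendsto_integral_condMean_sq_of_sub (H₁ _) (H₂ _)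
  have t3 : Tendsto (fun n => ∑ i ∈ Finset.range (M + 2),
      ∫ ω, |condMean (P n) (sigmoidRamp M i) (τ n) (Y n) ω -
        condMean (P n) (sigmoidRamp M i) (τs n) (D n) ω| ∂P n) atTop (𝓝 0) := by
    simpa using tendsto_finsetSum (Finset.range (M + 2)) fun i _ => H₁ (sigmoidRamp M i)
  filter_upwards [t1.eventually_lt_const hM, t2.eventually_lt_const hM,
    t3.eventually_lt_const (show 0 < η / 2 by positivity)] with n h1 h2 h3
  have iΔ : ∀ i, Integrable (fun ω => |condMean (P n) (sigmoidRamp M i) (τ n) (Y n) ω -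
        condMean (P n) (sigmoidRamp M i) (τs n) (D n) ω|) (P n) := fun i =>
    ((integrable_condMean _ _ _).sub (integrable_condMean _ _ _)).abs
  have iS : Integrable (fun ω => ∑ i ∈ Finset.range (M + 2),
      |condMean (P n) (sigmoidRamp M i) (τ n) (Y n) ω -
        condMean (P n) (sigmoidRamp M i) (τs n) (D n) ω|) (P n) :=
    integrable_finsetSum _ fun i _ => iΔ i
  have iE : Integrable (fun ω => (condBumpEnergy (P n) (τ n) (Y n) M ω +
      condBumpEnergy (P n) (τs n) (D n) M ω) / η) (P n) :=
    ((integrable_condBumpEnergy M).add (integrable_condBumpEnergy M)).div_const η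
  refine ⟨fun ω => ∑ i ∈ Finset.range (M + 2),
      |condMean (P n) (sigmoidRamp M i) (τ n) (Y n) ω -
        condMean (P n) (sigmoidRamp M i) (τs n) (D n) ω| +
      (condBumpEnergy (P n) (τ n) (Y n) M ω + condBumpEnergy (P n) (τs n) (D n) M ω) / η,
      iS.add iE, fun ω => ?_, ?_, ?_, ?_⟩
  · exact add_nonneg (Finset.sum_nonneg fun _ _ => abs_nonneg _)
      (div_nonneg (add_nonneg (condBumpEnergy_nonneg _ _) (condBumpEnergy_nonneg _ _)) hη.le)
  · rw [integral_add iS iE, integral_finsetSum _ fun i _ => iΔ i, integral_div,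
      integral_add (integrable_condBumpEnergy M) (integrable_condBumpEnergy M)]
    have : (∫ ω, condBumpEnergy (P n) (τ n) (Y n) M ω ∂P n +
        ∫ ω, condBumpEnergy (P n) (τs n) (D n) M ω ∂P n) / η ≤ η / 2 := by
      rw [div_le_iff₀ hη]; nlinarith
    linarith
  · filter_upwards [abs_randomCdf_sub_le (P := P n) (hτ n) (hY n) (hτs n) (hD n) hM0 hη]
      with ω hω u
    refine (hω u).trans ?_
    rw [add_div]
    linarith [div_nonneg (condBumpEnergy_nonneg (P := P n) (Z := τ n) (X := Y n) M ω) hη.le]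
  · filter_upwards [condDistrib_singleton_le (P := P n) (hτ n) (hY n) hM0 hη] with ω hω u
    refine (hω u).trans ?_
    rw [add_div]
    have : 0 ≤ ∑ i ∈ Finset.range (M + 2), |condMean (P n) (sigmoidRamp M i) (τ n) (Y n) ω -
        condMean (P n) (sigmoidRamp M i) (τs n) (D n) ω| :=
      Finset.sum_nonneg fun _ _ => abs_nonneg _
    linarith [div_nonneg (condBumpEnergy_nonneg (P := P n) (Z := τs n) (X := D n) M ω) hη.le]

end Control

/-! ### Convergence in probability of the cdf distance and of the conditional law of the p-value. -/

/-- Markov's inequality criterion for convergence in probability. -/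
lemma tendstoInProb_of_eventually_le {Ω : ℕ → Type*} [∀ n, MeasurableSpace (Ω n)]
    {P : ∀ n, Measure (Ω n)} [∀ n, IsProbabilityMeasure (P n)] {Z : ∀ n, Ω n → ℝ} {c : ℝ}
    (h : ∀ η : ℝ, 0 < η → ∀ᶠ n in atTop, ∃ R : Ω n → ℝ, Integrable R (P n) ∧
      (∀ᵐ ω ∂P n, 0 ≤ R ω) ∧ ∫ ω, R ω ∂P n ≤ η ∧ ∀ᵐ ω ∂P n, |Z n ω - c| ≤ η + R ω) :
    TendstoInProb P Z c := by
  intro ε hε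
  rw [ENNReal.tendsto_nhds_zero]
  intro δ hδ
  obtain ⟨d, hd0, hd⟩ : ∃ d : ℝ, 0 < d ∧ ENNReal.ofReal d ≤ δ := by
    obtain ⟨d, hd0, hd⟩ := ENNReal.lt_iff_exists_nnreal_btwn.1 hδ
    exact ⟨d, by exact_mod_cast hd0, by simpa using hd.le⟩
  -- The first bound leaves `R` at least `ε / 2` on the bad event; the second makes Markov's
  -- inequality give probability at most `d`.
  have hη : 0 < min (ε / 2) (d * ε / 2) := by positivity
  filter_upwards [h _ hη] with n ⟨R, hR, hR0, hRint, hle⟩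
  refine le_trans ?_ hd
  have hsub : P n {ω | ε ≤ |Z n ω - c|} ≤ P n {ω | ε / 2 ≤ R ω} := by
    refine measure_mono_ae ?_
    filter_upwards [hle] with ω hω hωε
    change ε ≤ |Z n ω - c| at hωε
    change ε / 2 ≤ R ω
    linarith [min_le_left (ε / 2) (d * ε / 2)]
  refine hsub.trans ((ENNReal.le_ofReal_iff_toReal_le (measure_ne_top _ _) hd0.le).2 ?_)
  have := mul_meas_ge_le_integral_of_nonneg hR0 hR (ε / 2)
  rw [measureReal_def] at this
  have h2 := min_le_right (ε / 2) (d * ε / 2)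
  have h3 : ε / 2 * (P n {ω | ε / 2 ≤ R ω}).toReal ≤ ε / 2 * d := by linarith
  exact le_of_mul_le_mul_left h3 (by positivity)

section Key

variable {Ω : ℕ → Type*} [∀ n, MeasurableSpace (Ω n)] {P : ∀ n, Measure (Ω n)}
  [∀ n, IsProbabilityMeasure (P n)] {𝓓 𝓨 : ℕ → Type*} [∀ n, MeasurableSpace (𝓓 n)]
  [∀ n, MeasurableSpace (𝓨 n)] {D : ∀ n, Ω n → 𝓓 n} {τ τs : ∀ n, Ω n → ℝ} {Y : ∀ n, Ω n → 𝓨 n}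

lemma condCdfsUniformlyClose_of_eventually_exists_error
    (h : ∀ η : ℝ, 0 < η → ∀ᶠ n in atTop, ∃ R : Ω n → ℝ, Integrable R (P n) ∧ (∀ ω, 0 ≤ R ω) ∧
      ∫ ω, R ω ∂P n ≤ η ∧ (∀ᵐ ω ∂P n, ∀ u,
        |randomCdf (P n) (τ n) (Y n) ω u - randomCdf (P n) (τs n) (D n) ω u| ≤ η + R ω) ∧
      ∀ᵐ ω ∂P n, ∀ u, (condDistrib (τ n) (Y n) (P n) (Y n ω)).real {u} ≤ η + R ω) :
    CondCdfsUniformlyClose P D τ τs Y := by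
  refine tendstoInProb_of_eventually_le fun η hη => ?_
  filter_upwards [h η hη] with n ⟨R, hR, hR0, hRint, hle, _⟩
  refine ⟨R, hR, Eventually.of_forall hR0, hRint, ?_⟩
  filter_upwards [hle] with ω hω
  rw [sub_zero, abs_of_nonneg (Real.iSup_nonneg fun _ => abs_nonneg _)]
  exact ciSup_le hω

/-- The p-value is compared with the conditional cdf of `τ n` at `τ n`. If one is at most `q` and
the other misses a level shifted by `2 * η`, then `R` exceeds `η`, an event with indicator at most
`R / η`. -/
lemma bootstrapValid_of_eventually_exists_error {T : ∀ n, 𝓓 n → ℝ} (hT : ∀ n, Measurable (T n))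
    (hτT : ∀ n ω, τ n ω = T n (D n ω)) (hτs : ∀ n, Measurable (τs n))
    (hD : ∀ n, Measurable (D n)) (hY : ∀ n, Measurable (Y n))
    (h : ∀ η : ℝ, 0 < η → ∀ᶠ n in atTop, ∃ R : Ω n → ℝ, Integrable R (P n) ∧ (∀ ω, 0 ≤ R ω) ∧
      ∫ ω, R ω ∂P n ≤ η ∧ (∀ᵐ ω ∂P n, ∀ u,
        |randomCdf (P n) (τ n) (Y n) ω u - randomCdf (P n) (τs n) (D n) ω u| ≤ η + R ω) ∧
      ∀ᵐ ω ∂P n, ∀ u, (condDistrib (τ n) (Y n) (P n) (Y n ω)).real {u} ≤ η + R ω) :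
    BootstrapValidConditionally P D τ τs Y := by
  intro q ⟨hq0, hq1⟩
  refine tendstoInProb_of_eventually_le fun ε hε => ?_
  -- The shifted levels `q ± 2 * η` must stay in (0, 1) for the probability integral transform.
  obtain ⟨η, hη0, hηε, hηq, hηq'⟩ : ∃ η : ℝ, 0 < η ∧ 4 * η ≤ ε ∧ 2 * η < q ∧ q + 2 * η < 1 := by
    refine ⟨min (ε / 4) (min (q / 4) ((1 - q) / 4)), by
      have : 0 < 1 - q := by linarith
      positivity, ?_, ?_, ?_⟩
    · linarith [min_le_left (ε / 4) (min (q / 4) ((1 - q) / 4))]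
    · linarith [min_le_right (ε / 4) (min (q / 4) ((1 - q) / 4)),
        min_le_left (q / 4) ((1 - q) / 4)]
    · linarith [min_le_right (ε / 4) (min (q / 4) ((1 - q) / 4)),
        min_le_right (q / 4) ((1 - q) / 4)]
  -- The error bound is used at a finer level `ζ`, since its mean gets divided by `η`.
  obtain ⟨ζ, hζ0, hζη, hζε⟩ : ∃ ζ : ℝ, 0 < ζ ∧ ζ ≤ η ∧ ζ + ζ / η ≤ ε := by
    refine ⟨min η (η * ε / 4), by positivity, min_le_left _ _, ?_⟩
    have h1 : min η (η * ε / 4) / η ≤ ε / 4 := by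
      rw [div_le_iff₀ hη0]; linarith [min_le_right η (η * ε / 4)]
    linarith [min_le_left η (η * ε / 4)]
  filter_upwards [h ζ hζ0] with n ⟨R, hR, hR0, hRint, hle, hat⟩
  have hτ : Measurable (τ n) := by
    rw [show τ n = T n ∘ D n from funext (hτT n)]
    exact (hT n).comp (hD n)
  have hmY : sigmaOf (Y n) ≤ (inferInstance : MeasurableSpace (Ω n)) := (hY n).comap_le
  let E : Ω n → ℝ := (P n)[R | sigmaOf (Y n)]
  have hE : Integrable E (P n) := integrable_condExp
  have hE0 : ∀ᵐ ω ∂P n, 0 ≤ E ω := condExp_nonneg (Eventually.of_forall hR0)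
  have hpv := bootstrapPValue_ae_eq (P := P n) (hT n) (hτT n) (hτs n) (hD n)
  have hlevel : ∀ c, MeasurableSet {p : 𝓨 n × ℝ |
      (condDistrib (τ n) (Y n) (P n) p.1).real (Set.Iic p.2) ≤ c} := fun c =>
    measurable_condDistrib_Iic measurableSet_Iic
  have hF : ∀ c, (P n)⟦{ω | randomCdf (P n) (τ n) (Y n) ω (τ n ω) ≤ c} | sigmaOf (Y n)⟧ =ᵐ[P n]
      fun ω => (condDistrib (τ n) (Y n) (P n) (Y n ω)).real
        {x | (condDistrib (τ n) (Y n) (P n) (Y n ω)).real (Set.Iic x) ≤ c} := fun c =>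
    condExp_indicator_ae_eq_condDistrib hτ (hY n) (hlevel c)
  have hFm : ∀ c, MeasurableSet {ω | randomCdf (P n) (τ n) (Y n) ω (τ n ω) ≤ c} := fun c =>
    ((hY n).prodMk hτ) (hlevel c)
  have hpm : MeasurableSet {ω | bootstrapPValue (P n) (D n) (τ n) (τs n) ω ≤ q} := by
    have hm : Measurable (bootstrapPValue (P n) (D n) (τ n) (τs n)) :=
      (stronglyMeasurable_condExp.mono (hD n).comap_le).measurable
    exact hm measurableSet_Iic
  have iind : ∀ {s : Set (Ω n)}, MeasurableSet s →
      Integrable (s.indicator fun _ => (1 : ℝ)) (P n) := fun hs =>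
    (integrable_const (1 : ℝ)).indicator hs
  have hup : (P n)⟦{ω | bootstrapPValue (P n) (D n) (τ n) (τs n) ω ≤ q} | sigmaOf (Y n)⟧ ≤ᵐ[P n]
      (P n)⟦{ω | randomCdf (P n) (τ n) (Y n) ω (τ n ω) ≤ q + 2 * η} | sigmaOf (Y n)⟧ +
        η⁻¹ • E := by
    refine (condExp_mono (iind hpm) ((iind (hFm (q + 2 * η))).add (hR.smul η⁻¹)) ?_).trans ?_
    · filter_upwards [hpv, hle] with ω h1 h2
      have h2 := abs_le.1 (h2 (τ n ω))
      have h3 : 0 ≤ η⁻¹ * R ω := mul_nonneg (inv_nonneg.2 hη0.le) (hR0 ω)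
      simp only [Set.indicator, Pi.add_apply, Pi.smul_apply, smul_eq_mul, Set.mem_ofPred_eq, h1]
      split_ifs with ha hb
      · linarith
      · have : η < R ω := by linarith
        have : 1 ≤ η⁻¹ * R ω := by
          rw [inv_mul_eq_div, le_div_iff₀ hη0]; linarith
        linarith
      · linarith
      · linarith
    · exact ((condExp_add (iind (hFm _)) (hR.smul η⁻¹) _).trans
        (EventuallyEq.rfl.add (condExp_smul η⁻¹ R _))).le
  have hlo : (P n)⟦{ω | randomCdf (P n) (τ n) (Y n) ω (τ n ω) ≤ q - 2 * η} | sigmaOf (Y n)⟧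
      ≤ᵐ[P n] (P n)⟦{ω | bootstrapPValue (P n) (D n) (τ n) (τs n) ω ≤ q} | sigmaOf (Y n)⟧ +
        η⁻¹ • E := by
    refine (condExp_mono (iind (hFm (q - 2 * η))) ((iind hpm).add (hR.smul η⁻¹)) ?_).trans ?_
    · filter_upwards [hpv, hle] with ω h1 h2
      have h2 := abs_le.1 (h2 (τ n ω))
      have h3 : 0 ≤ η⁻¹ * R ω := mul_nonneg (inv_nonneg.2 hη0.le) (hR0 ω)
      simp only [Set.indicator, Pi.add_apply, Pi.smul_apply, smul_eq_mul, Set.mem_ofPred_eq, h1]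
      split_ifs with ha hb
      · linarith
      · have : η < R ω := by linarith
        have : 1 ≤ η⁻¹ * R ω := by
          rw [inv_mul_eq_div, le_div_iff₀ hη0]; linarith
        linarith
      · linarith
      · linarith
    · exact ((condExp_add (iind hpm) (hR.smul η⁻¹) _).trans
        (EventuallyEq.rfl.add (condExp_smul η⁻¹ R _))).le
  refine ⟨fun ω => R ω + η⁻¹ * E ω, hR.add (hE.const_mul _), ?_, ?_, ?_⟩
  · filter_upwards [hE0] with ω h1
    exact add_nonneg (hR0 ω) (mul_nonneg (inv_nonneg.2 hη0.le) h1)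
  · rw [integral_add hR (hE.const_mul _), integral_const_mul, integral_condExp hmY,
      inv_mul_eq_div]
    have : (∫ ω, R ω ∂P n) / η ≤ ζ / η := by gcongr
    linarith
  · filter_upwards [hup, hlo, hF (q + 2 * η), hF (q - 2 * η), hat] with ω h1 h2 h3 h4 h5
    simp only [Pi.add_apply, Pi.smul_apply, smul_eq_mul] at h1 h2
    rw [h3] at h1
    rw [h4] at h2
    have h6 := (measureReal_cdf_le_mem_Icc _ (show 0 < q + 2 * η by linarith) hηq' h5).2
    have h7 := (measureReal_cdf_le_mem_Icc _ (show 0 < q - 2 * η by linarith)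
      (by linarith) h5).1
    have := hR0 ω
    rw [abs_le]
    constructor <;> linarith

end Key

/-! ### Convergence of means of almost surely bounded functions. -/

/-- Convergence in distribution implies convergence of the means of a continuous function that is
almost surely bounded along the sequence and in the limit. -/
lemma MeasureTheory.TendstoInDistribution.tendsto_integral_of_ae_bdd {Ω : ℕ → Type*}
    [∀ n, MeasurableSpace (Ω n)] {P : ∀ n, Measure (Ω n)} [∀ n, IsProbabilityMeasure (P n)]
    {Ω₀ : Type*} [MeasurableSpace Ω₀] {P₀ : Measure Ω₀} [IsProbabilityMeasure P₀]
    {E : Type*} [TopologicalSpace E] [MeasurableSpace E] [OpensMeasurableSpace E]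
    {Z : ∀ n, Ω n → E} {Z₀ : Ω₀ → E} (h : TendstoInDistribution Z atTop Z₀ P P₀)
    {f : E → ℝ} (hf : Continuous f) (C : ℝ) (hn : ∀ n, ∀ᵐ ω ∂P n, |f (Z n ω)| ≤ C)
    (h₀ : ∀ᵐ ω ∂P₀, |f (Z₀ ω)| ≤ C) :
    Tendsto (fun n => ∫ ω, f (Z n ω) ∂P n) atTop (𝓝 (∫ ω, f (Z₀ ω) ∂P₀)) := by
  -- Clamping at `C` makes `f` bounded everywhere without changing it on the almost sure range.
  let g : E →ᵇ ℝ := BoundedContinuousFunction.ofNormedAddCommGroup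
    (fun x => max (-C) (min C (f x))) (by fun_prop) |C| (fun x => by
      rw [Real.norm_eq_abs, abs_le]
      refine ⟨(neg_le_neg (le_abs_self C)).trans (le_max_left _ _), max_le (neg_le_abs C) ?_⟩
      exact (min_le_left _ _).trans (le_abs_self C))
  have hg : ∀ x, |f x| ≤ C → g x = f x := fun x hx => by
    change max (-C) (min C (f x)) = f x
    rw [min_eq_right (abs_le.1 hx).2, max_eq_right (abs_le.1 hx).1]
  have key := (ProbabilityMeasure.tendsto_iff_forall_integral_tendsto.1 h.tendsto) g
  have e₀ : ∫ x, g x ∂(P₀.map Z₀) = ∫ ω, f (Z₀ ω) ∂P₀ := by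
    rw [integral_map h.aemeasurable_limit g.continuous.measurable.aestronglyMeasurable]
    exact integral_congr_ae (h₀.mono fun ω hω => hg _ hω)
  have e : ∀ n, ∫ x, g x ∂((P n).map (Z n)) = ∫ ω, f (Z n ω) ∂P n := fun n => by
    rw [integral_map (h.forall_aemeasurable n) g.continuous.measurable.aestronglyMeasurable]
    exact integral_congr_ae ((hn n).mono fun ω hω => hg _ hω)
  simp only [ProbabilityMeasure.coe_mk, e, e₀] at key
  exact key

lemma abs_sub_le_of_abs_le {a b A B : ℝ} (ha : |a| ≤ A) (hb : |b| ≤ B) : |(|a - b|)| ≤ A + B := by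
  rw [abs_abs]; exact (abs_sub a b).trans (add_le_add ha hb)

/-! ### L² approximation by continuous functions and sums of products. -/

section Density

/-- The function `(s, t) ↦ a s * b t`. -/
noncomputable def tensorMul {S T : Type*} [TopologicalSpace S] [TopologicalSpace T]
    (a : S →ᵇ ℝ) (b : T →ᵇ ℝ) : S × T →ᵇ ℝ :=
  a.compContinuous ⟨Prod.fst, continuous_fst⟩ * b.compContinuous ⟨Prod.snd, continuous_snd⟩

variable {S T : Type*} [TopologicalSpace S] [PolishSpace S] [MeasurableSpace S] [BorelSpace S]
  [TopologicalSpace T] [PolishSpace T] [MeasurableSpace T] [BorelSpace T]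

/-- A square integrable function is `0` if it is orthogonal to all products of bounded continuous
functions of the two coordinates. -/
lemma ae_eq_zero_of_forall_integral_tensorMul_eq_zero (μ : Measure (S × T)) [IsFiniteMeasure μ]
    {f : S × T → ℝ} (hf : Integrable f μ)
    (h : ∀ (a : S →ᵇ ℝ) (b : T →ᵇ ℝ), ∫ p, f p * tensorMul a b p ∂μ = 0) : f =ᵐ[μ] 0 := by
  have hbdd : ∀ g : S × T →ᵇ ℝ, ∀ {u : S × T → ℝ}, Integrable u μ →
      Integrable (fun p => u p * g p) μ := fun g u hu =>
    hu.mul_bdd (c := ‖g‖) g.continuous.measurable.aestronglyMeasurable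
      (Eventually.of_forall g.norm_coe_le_norm)
  have hsub : ∀ p, max (f p) 0 - max (-f p) 0 = f p := fun p => by
    rcases le_total (f p) 0 with h | h <;> simp [h]
  have hpos : Integrable (fun p => max (f p) 0) μ := hf.pos_part
  have hneg : Integrable (fun p => max (-f p) 0) μ := hf.neg_part
  have hfin : ∀ u : S × T → ℝ, Integrable u μ →
      IsFiniteMeasure (μ.withDensity fun p => ENNReal.ofReal (u p)) := fun u hu =>
    isFiniteMeasure_withDensity_ofReal hu.2
  have := hfin _ hpos
  have := hfin _ hneg
  have hint : ∀ u : S × T → ℝ, Integrable u μ → (∀ p, 0 ≤ u p) → ∀ g : S × T →ᵇ ℝ,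
      ∫ p, g p ∂(μ.withDensity fun p => ENNReal.ofReal (u p)) = ∫ p, u p * g p ∂μ := by
    intro u hu h0 g
    rw [integral_withDensity_eq_integral_toReal_smul₀ hu.1.aemeasurable.ennreal_ofReal
      (Eventually.of_forall fun _ => ENNReal.ofReal_lt_top)]
    simp only [smul_eq_mul, ENNReal.toReal_ofReal (h0 _)]
  -- The positive and negative parts of `f` are densities of finite measures that agree on products,
  -- hence coincide.
  have hEq : (μ.withDensity fun p => ENNReal.ofReal (max (f p) 0)) =
      μ.withDensity fun p => ENNReal.ofReal (max (-f p) 0) := by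
    refine Measure.ext_of_integral_mul_boundedContinuousFunction fun a b => ?_
    change ∫ p, tensorMul a b p ∂_ = ∫ p, tensorMul a b p ∂_
    rw [hint _ hpos (fun _ => le_max_right _ _), hint _ hneg (fun _ => le_max_right _ _),
      ← sub_eq_zero, ← integral_sub (hbdd (tensorMul a b) hpos)
      (hbdd (tensorMul a b) hneg)]
    refine (integral_congr_ae (Eventually.of_forall fun p => ?_)).trans (h a b)
    change max (f p) 0 * tensorMul a b p - max (-f p) 0 * tensorMul a b p = f p * tensorMul a b p
    rw [← sub_mul, hsub]
  have hae := (withDensity_eq_iff hpos.1.aemeasurable.ennreal_ofReal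
    hneg.1.aemeasurable.ennreal_ofReal hpos.lintegral_lt_top.ne).1 hEq
  filter_upwards [hae] with p hp
  rw [ENNReal.ofReal_eq_ofReal_iff (le_max_right _ _) (le_max_right _ _)] at hp
  change f p = 0
  rw [← hsub p, hp, sub_self]

/-- Sums of products of bounded continuous functions of the two coordinates are dense in `L²`. -/
lemma exists_span_tensorMul_integral_sq_sub_le (μ : Measure (S × T)) [IsProbabilityMeasure μ]
    {f : S × T → ℝ} (hf : MemLp f 2 μ) {ε : ℝ} (hε : 0 < ε) :
    ∃ φ ∈ Submodule.span ℝ (Set.range fun q : (S →ᵇ ℝ) × (T →ᵇ ℝ) => tensorMul q.1 q.2),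
      ∫ p, (f p - φ p) ^ 2 ∂μ < ε := by
  have hφ : ∀ φ : S × T →ᵇ ℝ, MemLp φ 2 μ := fun φ =>
    MemLp.of_bound φ.continuous.measurable.aestronglyMeasurable ‖φ‖
      (Eventually.of_forall φ.norm_coe_le_norm)
  let L : (S × T →ᵇ ℝ) →ₗ[ℝ] Lp ℝ 2 μ :=
    { toFun := fun φ => (hφ φ).toLp
      map_add' := fun φ ψ => MemLp.toLp_add (hφ φ) (hφ ψ)
      map_smul' := fun c φ => MemLp.toLp_const_smul c (hφ φ) }
  set V := Submodule.span ℝ (Set.range fun q : (S →ᵇ ℝ) × (T →ᵇ ℝ) => tensorMul q.1 q.2)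
  -- In a Hilbert space a subspace with trivial orthogonal complement is dense.
  have hbot : (V.map L)ᗮ = ⊥ := by
    rw [Submodule.eq_bot_iff]
    intro u hu
    have hu0 : u =ᵐ[μ] 0 := by
      refine ae_eq_zero_of_forall_integral_tensorMul_eq_zero μ
        ((Lp.memLp u).integrable (by norm_num)) fun a b => ?_
      have hmem : L (tensorMul a b) ∈ V.map L :=
        Submodule.mem_map_of_mem (Submodule.subset_span ⟨(a, b), rfl⟩)
      have h0 := (Submodule.mem_orthogonal _ _).1 hu _ hmem
      rw [L2.inner_def] at h0
      rw [← h0]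
      refine integral_congr_ae ?_
      filter_upwards [(hφ (tensorMul a b)).coeFn_toLp] with p hp
      change u p * tensorMul a b p = inner ℝ (L (tensorMul a b) p) (u p)
      rw [show L (tensorMul a b) p = tensorMul a b p from hp]
      rfl
    exact (Lp.eq_zero_iff_ae_eq_zero).2 hu0
  have hdense : (V.map L).topologicalClosure = ⊤ :=
    Submodule.topologicalClosure_eq_top_iff.2 hbot
  have hcl : hf.toLp ∈ closure ((V.map L : Submodule ℝ (Lp ℝ 2 μ)) : Set (Lp ℝ 2 μ)) := by
    rw [← Submodule.topologicalClosure_coe, hdense]; trivial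
  obtain ⟨v, hv, hdist⟩ := Metric.mem_closure_iff.1 hcl (√ε) (Real.sqrt_pos.2 hε)
  obtain ⟨φ, hφV, rfl⟩ := hv
  refine ⟨φ, hφV, ?_⟩
  have hsub : dist hf.toLp (L φ) ^ 2 = ∫ p, (f p - φ p) ^ 2 ∂μ := by
    rw [dist_eq_norm, ← real_inner_self_eq_norm_sq, L2.inner_def]
    refine integral_congr_ae ?_
    filter_upwards [Lp.coeFn_sub hf.toLp (L φ), hf.coeFn_toLp, (hφ φ).coeFn_toLp] with p h1 h2 h3
    have h3' : L φ p = φ p := h3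
    rw [h1, Pi.sub_apply, h2, h3', real_inner_self_eq_norm_sq, Real.norm_eq_abs, sq_abs]
  rw [← hsub]
  calc dist hf.toLp (L φ) ^ 2 < √ε ^ 2 := by
        gcongr
    _ = ε := Real.sq_sqrt hε.le

/-- Bounded continuous functions are dense in `L²`. -/
lemma exists_boundedContinuous_integral_sq_sub_le (μ : Measure S) [IsProbabilityMeasure μ]
    {f : S → ℝ} (hf : MemLp f 2 μ) {ε : ℝ} (hε : 0 < ε) :
    ∃ φ : S →ᵇ ℝ, ∫ x, (f x - φ x) ^ 2 ∂μ ≤ ε := by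
  let := TopologicalSpace.upgradeIsCompletelyMetrizable S
  obtain ⟨φ, hφ, _⟩ := MemLp.exists_boundedContinuous_integral_rpow_sub_le (p := 2) (by norm_num)
    (μ := μ) (f := f) (by simpa using hf) hε
  refine ⟨φ, ?_⟩
  simpa using hφ

end Density

lemma integral_abs_le_add_integral_sq_div {Ω : Type*} [MeasurableSpace Ω] {P : Measure Ω}
    [IsProbabilityMeasure P] {f : Ω → ℝ} (hf : MemLp f 2 P) {δ : ℝ} (hδ : 0 < δ) :
    ∫ ω, |f ω| ∂P ≤ δ + (∫ ω, f ω ^ 2 ∂P) / δ := by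
  have h2 : Integrable (fun ω => f ω ^ 2) P := hf.integrable_sq
  have : ∫ ω, (δ + f ω ^ 2 / δ) ∂P = δ + (∫ ω, f ω ^ 2 ∂P) / δ := by
    rw [integral_add (integrable_const _) (h2.div_const _), integral_div]; simp
  rw [← this]
  refine integral_mono (hf.integrable (by norm_num)).abs
    ((integrable_const _).add (h2.div_const _)) fun ω => ?_
  change |f ω| ≤ δ + f ω ^ 2 / δ
  rw [← sub_le_iff_le_add', le_div_iff₀ hδ, ← sq_abs]
  nlinarith [sq_nonneg (|f ω| - δ)]

/-! ### Conditional means on one probability space. -/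

section OneSpace

variable {Ω : Type*} [MeasurableSpace Ω] {P : Measure Ω} [IsProbabilityMeasure P]
  {S T 𝓧 : Type*} [TopologicalSpace S] [TopologicalSpace T] [MeasurableSpace T]
  [MeasurableSpace 𝓧]

lemma memLp_condMean (h : S →ᵇ ℝ) (Z : Ω → S) (X : Ω → 𝓧) : MemLp (condMean P h Z X) 2 P :=
  MemLp.of_bound (integrable_condMean h Z X).1 ‖h‖ (abs_condMean_le h Z X)

lemma exists_condMean_eq_comp (h : S →ᵇ ℝ) (Z : Ω → S) {X : Ω → 𝓧} (hX : Measurable X) :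
    ∃ G : 𝓧 → ℝ, Measurable G ∧ MemLp G 2 (P.map X) ∧ condMean P h Z X = G ∘ X := by
  have hm : Measurable[sigmaOf X] (condMean P h Z X) := stronglyMeasurable_condExp.measurable
  obtain ⟨G, hG, hGX⟩ := hm.exists_eq_measurable_comp
  refine ⟨G, hG, ?_, hGX⟩
  rw [memLp_map_measure_iff hG.aestronglyMeasurable hX.aemeasurable, ← hGX]
  exact memLp_condMean h Z X

lemma memLp_comp_boundedContinuous [OpensMeasurableSpace T] (h : T →ᵇ ℝ) {Z : Ω → T}
    (hZ : Measurable Z) : MemLp (fun ω => h (Z ω)) 2 P :=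
  MemLp.of_bound ((h.continuous.measurable.comp hZ).aestronglyMeasurable) ‖h‖
    (Eventually.of_forall fun ω => h.norm_coe_le_norm (Z ω))

/-- A conditional expectation given `X` is close in `L²` to a bounded continuous function
of `X`. -/
lemma exists_integral_sq_condMean_sub_le [PolishSpace T] [BorelSpace T]
    (h : S →ᵇ ℝ) (Z : Ω → S) {X : Ω → T} (hX : Measurable X) {ε : ℝ} (hε : 0 < ε) :
    ∃ ψ : T →ᵇ ℝ, ∫ ω, (condMean P h Z X ω - ψ (X ω)) ^ 2 ∂P ≤ ε := by
  obtain ⟨G, hG, hL, hGX⟩ := exists_condMean_eq_comp (P := P) h Z hX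
  have := Measure.isProbabilityMeasure_map (μ := P) hX.aemeasurable
  obtain ⟨ψ, hψ⟩ := exists_boundedContinuous_integral_sq_sub_le (P.map X) hL hε
  refine ⟨ψ, ?_⟩
  rw [integral_map hX.aemeasurable
    (f := fun x => (G x - ψ x) ^ 2)
    ((hG.sub ψ.continuous.measurable).pow_const 2).aestronglyMeasurable] at hψ
  rw [hGX]
  exact hψ

/-- A conditional expectation given a pair is close in `L²` to a sum of products of bounded
continuous functions of the two components. -/
lemma exists_span_integral_sq_condMean_sub_lt {𝓢 𝓣 : Type*} [TopologicalSpace 𝓢] [PolishSpace 𝓢]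
    [MeasurableSpace 𝓢] [BorelSpace 𝓢] [TopologicalSpace 𝓣] [PolishSpace 𝓣] [MeasurableSpace 𝓣]
    [BorelSpace 𝓣] (h : S →ᵇ ℝ) (Z : Ω → S) {V : Ω → 𝓢 × 𝓣} (hV : Measurable V) {ε : ℝ}
    (hε : 0 < ε) :
    ∃ φ ∈ Submodule.span ℝ (Set.range fun q : (𝓢 →ᵇ ℝ) × (𝓣 →ᵇ ℝ) => tensorMul q.1 q.2),
      ∫ ω, (condMean P h Z V ω - φ (V ω)) ^ 2 ∂P < ε := by
  obtain ⟨G, hG, hL, hGX⟩ := exists_condMean_eq_comp (P := P) h Z hV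
  have := Measure.isProbabilityMeasure_map (μ := P) hV.aemeasurable
  obtain ⟨φ, hφ, hlt⟩ := exists_span_tensorMul_integral_sq_sub_le (P.map V) hL hε
  refine ⟨φ, hφ, ?_⟩
  rw [integral_map hV.aemeasurable
    (f := fun x => (G x - φ x) ^ 2)
    ((hG.sub φ.continuous.measurable).pow_const 2).aestronglyMeasurable] at hlt
  rw [hGX]
  exact hlt

/-- Conditioning on less brings conditional expectations closer in mean. -/
lemma integral_abs_condMean_sub_condMean_le [OpensMeasurableSpace T] {𝓨 : Type*}
    [MeasurableSpace 𝓨] (h : S →ᵇ ℝ) (Z : Ω → S) {X : Ω → 𝓧} (hX : Measurable X) {X' : Ω → 𝓨}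
    (hX' : Measurable[sigmaOf X] X') (φ : T →ᵇ ℝ) {V : Ω → T} (hV : Measurable V) :
    ∫ ω, |condMean P h Z X' ω - condMean P φ V X' ω| ∂P ≤
      ∫ ω, |condMean P h Z X ω - φ (V ω)| ∂P := by
  have h1 : P[condMean P h Z X | sigmaOf X'] =ᵐ[P] condMean P h Z X' :=
    condExp_condExp_of_le hX'.comap_le hX.comap_le
  have h2 := condExp_sub (integrable_condMean (P := P) h Z X)
    (integrable_comp_boundedContinuous φ hV) (sigmaOf X')
  refine le_trans (le_of_eq ?_) (integral_abs_condExp_le (m := sigmaOf X')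
    (fun ω => condMean P h Z X ω - φ (V ω)))
  refine integral_congr_ae ?_
  filter_upwards [h1, h2] with ω e1 e2
  change _ = |(P[condMean P h Z X - fun ω => φ (V ω) | sigmaOf X']) ω|
  rw [e2, Pi.sub_apply, e1]
  rfl

/-- The mean squared error of a prediction of a conditional expectation. -/
lemma integral_sq_condMean_sub_eq [TopologicalSpace 𝓧] [OpensMeasurableSpace 𝓧]
    [OpensMeasurableSpace T] (b : T →ᵇ ℝ) {Z : Ω → T} (hZ : Measurable Z) {X : Ω → 𝓧}
    (hX : Measurable X) (ψ : 𝓧 →ᵇ ℝ) :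
    ∫ ω, (condMean P b Z X ω - ψ (X ω)) ^ 2 ∂P =
      ∫ ω, condMean P b Z X ω ^ 2 ∂P - 2 * ∫ ω, b (Z ω) * ψ (X ω) ∂P +
        ∫ ω, ψ (X ω) ^ 2 ∂P := by
  have hψ := memLp_comp_boundedContinuous (P := P) ψ hX
  have hb := memLp_comp_boundedContinuous (P := P) b hZ
  have hB := memLp_condMean (P := P) b Z X
  -- Since `ψ (X ω)` is known given `X`, the cross term becomes the mean of a continuous function of
  -- `(X, Z)`, which weak convergence controls.
  have hcross : ∫ ω, condMean P b Z X ω * ψ (X ω) ∂P = ∫ ω, b (Z ω) * ψ (X ω) ∂P := by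
    have hm : StronglyMeasurable[sigmaOf X] fun ω => ψ (X ω) :=
      (ψ.continuous.measurable.comp (comap_measurable X)).stronglyMeasurable
    rw [← integral_condExp hX.comap_le (f := fun ω => b (Z ω) * ψ (X ω))]
    refine integral_congr_ae ?_
    exact (condExp_mul_of_stronglyMeasurable_right hm (hb.integrable_mul hψ)
      (hb.integrable (by norm_num))).symm
  have e : ∀ ω, (condMean P b Z X ω - ψ (X ω)) ^ 2 = condMean P b Z X ω ^ 2 -
      2 * (condMean P b Z X ω * ψ (X ω)) + ψ (X ω) ^ 2 := fun ω => by ring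
  have i2 : Integrable (fun ω => 2 * (condMean P b Z X ω * ψ (X ω))) P :=
    (hB.integrable_mul hψ).const_mul 2
  have i3 : Integrable (fun ω => condMean P b Z X ω ^ 2 -
      2 * (condMean P b Z X ω * ψ (X ω))) P := hB.integrable_sq.sub i2
  simp_rw [e]
  rw [integral_add i3 hψ.integrable_sq, integral_sub hB.integrable_sq i2,
    integral_const_mul, hcross]

end OneSpace

lemma integral_abs_sub_le {Ω : Type*} [MeasurableSpace Ω] {P : Measure Ω} {f g h : Ω → ℝ}
    (hf : Integrable f P) (hg : Integrable g P) (hh : Integrable h P) :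
    ∫ ω, |f ω - h ω| ∂P ≤ ∫ ω, |f ω - g ω| ∂P + ∫ ω, |g ω - h ω| ∂P := by
  have i₁ : Integrable (fun ω => |f ω - g ω|) P := (hf.sub hg).abs
  have i₂ : Integrable (fun ω => |g ω - h ω|) P := (hg.sub hh).abs
  rw [← integral_add i₁ i₂]
  exact integral_mono (hf.sub hh).abs (i₁.add i₂) fun ω => abs_sub_le _ _ _

section Linear

variable {Ω : Type*} [MeasurableSpace Ω] {P : Measure Ω} [IsProbabilityMeasure P]
  {S T : Type*} [TopologicalSpace S] [MeasurableSpace S] [OpensMeasurableSpace S]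
  [TopologicalSpace T] [MeasurableSpace T]

lemma integral_abs_condMean_add_sub_le [OpensMeasurableSpace T] {V : Ω → S} (hV : Measurable V)
    {X : Ω → T} (hX : Measurable X) (φ₁ φ₂ : S →ᵇ ℝ) (Φ₁ Φ₂ : T →ᵇ ℝ) :
    ∫ ω, |condMean P (φ₁ + φ₂) V X ω - (Φ₁ + Φ₂) (X ω)| ∂P ≤
      ∫ ω, |condMean P φ₁ V X ω - Φ₁ (X ω)| ∂P + ∫ ω, |condMean P φ₂ V X ω - Φ₂ (X ω)| ∂P := by
  have i : ∀ (φ : S →ᵇ ℝ) (Φ : T →ᵇ ℝ),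
      Integrable (fun ω => |condMean P φ V X ω - Φ (X ω)|) P := fun φ Φ =>
    ((integrable_condMean φ V X).sub (integrable_comp_boundedContinuous Φ hX)).abs
  rw [← integral_add (i _ _) (i _ _)]
  refine integral_mono_ae (i _ _) ((i _ _).add (i _ _)) ?_
  have hadd : condMean P (φ₁ + φ₂) V X =ᵐ[P] condMean P φ₁ V X + condMean P φ₂ V X :=
    condExp_add (integrable_comp_boundedContinuous φ₁ hV)
      (integrable_comp_boundedContinuous φ₂ hV) _
  filter_upwards [hadd] with ω hω
  simp only [hω, Pi.add_apply, BoundedContinuousFunction.add_apply]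
  rw [add_sub_add_comm]
  exact abs_add_le _ _

end Linear

lemma integral_abs_condMean_smul_sub {Ω : Type*} [MeasurableSpace Ω] {P : Measure Ω}
    {S T : Type*} [TopologicalSpace S] [TopologicalSpace T] [MeasurableSpace T] (V : Ω → S)
    (X : Ω → T) (c : ℝ) (φ : S →ᵇ ℝ) (Φ : T →ᵇ ℝ) :
    ∫ ω, |condMean P (c • φ) V X ω - (c • Φ) (X ω)| ∂P =
      |c| * ∫ ω, |condMean P φ V X ω - Φ (X ω)| ∂P := by
  rw [← integral_const_mul]
  have hsmul : condMean P (c • φ) V X =ᵐ[P] c • condMean P φ V X := condExp_smul c _ _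
  refine integral_congr_ae ?_
  filter_upwards [hsmul] with ω hω
  simp only [hω, Pi.smul_apply, BoundedContinuousFunction.coe_smul, smul_eq_mul]
  rw [← mul_sub, abs_mul]

/-! ### Passing to the limit, and conditioning on the coarser variable. -/

section Limits

variable {Ω : ℕ → Type*} [∀ n, MeasurableSpace (Ω n)] {P : ∀ n, Measure (Ω n)}
  [∀ n, IsProbabilityMeasure (P n)] {Ω₀ : Type*} [MeasurableSpace Ω₀] {P₀ : Measure Ω₀}
  [IsProbabilityMeasure P₀]

lemma MeasureTheory.TendstoInDistribution.fst {E F : Type*} [TopologicalSpace E]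
    [MeasurableSpace E] [BorelSpace E] [TopologicalSpace F] [MeasurableSpace F]
    [OpensMeasurableSpace (E × F)] {U : ∀ n, Ω n → E} {V : ∀ n, Ω n → F} {U₀ : Ω₀ → E}
    {V₀ : Ω₀ → F} (h : TendstoInDistribution (fun n ω => (U n ω, V n ω)) atTop
      (fun ω => (U₀ ω, V₀ ω)) P P₀) : TendstoInDistribution U atTop U₀ P P₀ :=
  h.continuous_comp continuous_fst

lemma MeasureTheory.TendstoInDistribution.snd {E F : Type*} [TopologicalSpace E]
    [MeasurableSpace E] [TopologicalSpace F] [MeasurableSpace F] [BorelSpace F]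
    [OpensMeasurableSpace (E × F)] {U : ∀ n, Ω n → E} {V : ∀ n, Ω n → F} {U₀ : Ω₀ → E}
    {V₀ : Ω₀ → F} (h : TendstoInDistribution (fun n ω => (U n ω, V n ω)) atTop
      (fun ω => (U₀ ω, V₀ ω)) P P₀) : TendstoInDistribution V atTop V₀ P P₀ :=
  h.continuous_comp continuous_snd

lemma tendsto_integral_condMean_sq {S : Type*} [TopologicalSpace S] {𝓧 : ℕ → Type*}
    [∀ n, MeasurableSpace (𝓧 n)] {𝓧₀ : Type*} [MeasurableSpace 𝓧₀] {g : S →ᵇ ℝ}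
    {Z : ∀ n, Ω n → S} {X : ∀ n, Ω n → 𝓧 n} {Z₀ : Ω₀ → S} {X₀ : Ω₀ → 𝓧₀}
    (h : TendstoInDistribution (fun n => condMean (P n) g (Z n) (X n)) atTop
      (condMean P₀ g Z₀ X₀) P P₀) :
    Tendsto (fun n => ∫ ω, condMean (P n) g (Z n) (X n) ω ^ 2 ∂P n) atTop
      (𝓝 (∫ ω, condMean P₀ g Z₀ X₀ ω ^ 2 ∂P₀)) := by
  refine h.tendsto_integral_of_ae_bdd (f := fun x => x ^ 2) (by fun_prop) (‖g‖ ^ 2)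
    (fun n => ?_) ?_
  · filter_upwards [abs_condMean_le (P := P n) g (Z n) (X n)] with ω hω
    rw [abs_pow]; gcongr
  · filter_upwards [abs_condMean_le (P := P₀) g Z₀ X₀] with ω hω
    rw [abs_pow]; gcongr

lemma tendsto_integral_abs_condMean_sub_of_joint {S : Type*} [TopologicalSpace S]
    {𝓧 𝓓 : ℕ → Type*} [∀ n, MeasurableSpace (𝓧 n)] [∀ n, MeasurableSpace (𝓓 n)] {𝓧₀ : Type*}
    [MeasurableSpace 𝓧₀] {g : S →ᵇ ℝ} {Z Z' : ∀ n, Ω n → S} {X : ∀ n, Ω n → 𝓧 n}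
    {D : ∀ n, Ω n → 𝓓 n} {Z₀ : Ω₀ → S} {X₀ : Ω₀ → 𝓧₀}
    (h : TendstoInDistribution
      (fun n ω => (condMean (P n) g (Z n) (X n) ω, condMean (P n) g (Z' n) (D n) ω)) atTop
      (fun ω => (condMean P₀ g Z₀ X₀ ω, condMean P₀ g Z₀ X₀ ω)) P P₀) :
    Tendsto (fun n => ∫ ω, |condMean (P n) g (Z n) (X n) ω -
      condMean (P n) g (Z' n) (D n) ω| ∂P n) atTop (𝓝 0) := by
  have key := h.tendsto_integral_of_ae_bdd (f := fun p => |p.1 - p.2|) (by fun_prop)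
    (‖g‖ + ‖g‖) (fun n => ?_) ?_
  · simpa using key
  · filter_upwards [abs_condMean_le (P := P n) g (Z n) (X n),
      abs_condMean_le (P := P n) g (Z' n) (D n)] with ω h1 h2
    exact abs_sub_le_of_abs_le h1 h2
  · filter_upwards [abs_condMean_le (P := P₀) g Z₀ X₀] with ω h1
    exact abs_sub_le_of_abs_le h1 h1

variable {𝓢 𝓣 : Type*} [TopologicalSpace 𝓢] [MeasurableSpace 𝓢] [BorelSpace 𝓢]
  [TopologicalSpace 𝓣] [MeasurableSpace 𝓣] [BorelSpace 𝓣]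
  {X' : Ω₀ → 𝓢} {X'' : Ω₀ → 𝓣} {Xn' : ∀ n, Ω n → 𝓢} {Xn'' : ∀ n, Ω n → 𝓣}

/-- After expanding the square, the second moment of the conditional mean converges by `hC`; the
cross term and the square of `ψ` converge by `hV`. -/
lemma tendsto_integral_sq_condMean_sub [PolishSpace 𝓣] (hX' : Measurable X') (hX'' : Measurable X'')
    (hXn' : ∀ n, Measurable (Xn' n)) (hXn'' : ∀ n, Measurable (Xn'' n))
    (hV : TendstoInDistribution (fun n ω => (Xn' n ω, Xn'' n ω)) atTop
      (fun ω => (X' ω, X'' ω)) P P₀) (hC : CondWeakConv P P₀ Xn'' Xn' X'' X')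
    (b : 𝓣 →ᵇ ℝ) (ψ : 𝓢 →ᵇ ℝ) :
    Tendsto (fun n => ∫ ω, (condMean (P n) b (Xn'' n) (Xn' n) ω - ψ (Xn' n ω)) ^ 2 ∂P n) atTop
      (𝓝 (∫ ω, (condMean P₀ b X'' X' ω - ψ (X' ω)) ^ 2 ∂P₀)) := by
  have hcross : ∀ p : 𝓢 × 𝓣, |b p.2 * ψ p.1| ≤ ‖b‖ * ‖ψ‖ := fun p => by
    rw [abs_mul]
    exact mul_le_mul (b.norm_coe_le_norm _) (ψ.norm_coe_le_norm _) (abs_nonneg _) (norm_nonneg _)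
  have hsq : ∀ p : 𝓢 × 𝓣, |ψ p.1 ^ 2| ≤ ‖ψ‖ ^ 2 := fun p => by
    rw [abs_pow]
    exact pow_le_pow_left₀ (abs_nonneg _) (ψ.norm_coe_le_norm _) 2
  have t1 := tendsto_integral_condMean_sq (hC b)
  have t2 := hV.tendsto_integral_of_ae_bdd (f := fun p => b p.2 * ψ p.1) (by fun_prop) _
    (fun n => Eventually.of_forall fun ω => hcross _) (Eventually.of_forall fun ω => hcross _)
  have t3 := hV.tendsto_integral_of_ae_bdd (f := fun p => ψ p.1 ^ 2) (by fun_prop) _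
    (fun n => Eventually.of_forall fun ω => hsq _) (Eventually.of_forall fun ω => hsq _)
  rw [integral_sq_condMean_sub_eq b hX'' hX' ψ]
  simp_rw [fun n => integral_sq_condMean_sub_eq (P := P n) b (hXn'' n) (hXn' n) ψ]
  exact (t1.sub (t2.const_mul 2)).add t3

/-- The factor `a (X' ω)` is known given `X'` and comes out of the conditional expectation. -/
lemma integral_abs_condMean_tensorMul_sub_le {Ω : Type*} [MeasurableSpace Ω] {P : Measure Ω}
    [IsProbabilityMeasure P] {X' : Ω → 𝓢} {X'' : Ω → 𝓣} (hX' : Measurable X')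
    (hX'' : Measurable X'') (a ψ : 𝓢 →ᵇ ℝ) (b : 𝓣 →ᵇ ℝ) {δ : ℝ} (hδ : 0 < δ) :
    ∫ ω, |condMean P (tensorMul a b) (fun ω => (X' ω, X'' ω)) X' ω - (a * ψ) (X' ω)| ∂P ≤
      ‖a‖ * (δ + (∫ ω, (condMean P b X'' X' ω - ψ (X' ω)) ^ 2 ∂P) / δ) := by
  have ha := memLp_comp_boundedContinuous (P := P) a hX'
  have hb := memLp_comp_boundedContinuous (P := P) b hX''
  have hdiff : MemLp (fun ω => condMean P b X'' X' ω - ψ (X' ω)) 2 P :=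
    (memLp_condMean (P := P) b X'' X').sub (memLp_comp_boundedContinuous (P := P) ψ hX')
  have hm : StronglyMeasurable[sigmaOf X'] fun ω => a (X' ω) :=
    (a.continuous.measurable.comp (comap_measurable X')).stronglyMeasurable
  have hpull : condMean P (tensorMul a b) (fun ω => (X' ω, X'' ω)) X' =ᵐ[P]
      fun ω => a (X' ω) * condMean P b X'' X' ω :=
    condExp_mul_of_stronglyMeasurable_left hm (ha.integrable_mul hb) (hb.integrable (by norm_num))
  refine le_trans ?_ (mul_le_mul_of_nonneg_left
    (integral_abs_le_add_integral_sq_div hdiff hδ) (norm_nonneg a))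
  rw [← integral_const_mul]
  refine integral_mono_of_nonneg (Eventually.of_forall fun _ => abs_nonneg _)
    ((hdiff.integrable (by norm_num)).abs.const_mul _) ?_
  filter_upwards [hpull] with ω hω
  rw [hω, BoundedContinuousFunction.mul_apply, ← mul_sub, abs_mul]
  exact mul_le_mul_of_nonneg_right (a.norm_coe_le_norm _) (abs_nonneg _)

variable [PolishSpace 𝓢] [PolishSpace 𝓣]

/-- For a sum `φ` of products of bounded continuous functions, the conditional expectation of
`φ (Xn', Xn'')` given `Xn'` is close to a bounded continuous function of `Xn'` that does not depend
on `n`. -/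
lemma exists_integral_abs_condMean_sub_lt (hX' : Measurable X') (hX'' : Measurable X'')
    (hXn' : ∀ n, Measurable (Xn' n)) (hXn'' : ∀ n, Measurable (Xn'' n))
    (hV : TendstoInDistribution (fun n ω => (Xn' n ω, Xn'' n ω)) atTop
      (fun ω => (X' ω, X'' ω)) P P₀) (hC : CondWeakConv P P₀ Xn'' Xn' X'' X')
    {φ : 𝓢 × 𝓣 →ᵇ ℝ}
    (hφ : φ ∈ Submodule.span ℝ (Set.range fun q : (𝓢 →ᵇ ℝ) × (𝓣 →ᵇ ℝ) => tensorMul q.1 q.2)) :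
    ∀ ε : ℝ, 0 < ε → ∃ Φ : 𝓢 →ᵇ ℝ,
      ∫ ω, |condMean P₀ φ (fun ω => (X' ω, X'' ω)) X' ω - Φ (X' ω)| ∂P₀ < ε ∧
      ∀ᶠ n in atTop,
        ∫ ω, |condMean (P n) φ (fun ω => (Xn' n ω, Xn'' n ω)) (Xn' n) ω -
          Φ (Xn' n ω)| ∂P n < ε := by
  have hV₀ : Measurable fun ω => (X' ω, X'' ω) := hX'.prodMk hX''
  induction hφ using Submodule.span_induction with
  | mem φ hφ =>
    obtain ⟨⟨a, b⟩, rfl⟩ := hφ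
    intro ε hε
    have hA : 0 < ‖a‖ + 1 := by positivity
    -- The `+ 1` keeps the divisor positive when `a = 0`.
    obtain ⟨δ, hδ, hδε⟩ : ∃ δ : ℝ, 0 < δ ∧ (‖a‖ + 1) * (δ + δ) = ε :=
      ⟨ε / (2 * (‖a‖ + 1)), by positivity, by field_simp; ring⟩
    obtain ⟨ψ, hψ⟩ := exists_integral_sq_condMean_sub_le (P := P₀) b X'' hX'
      (show 0 < δ ^ 2 / 2 by positivity)
    have hψ' := hψ.trans_lt (half_lt_self (show 0 < δ ^ 2 by positivity))
    have aux : ∀ I : ℝ, I < δ ^ 2 → ‖a‖ * (δ + I / δ) < ε := fun I hI => by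
      have h1 : I / δ < δ := by rw [div_lt_iff₀ hδ]; nlinarith
      nlinarith [norm_nonneg a]
    refine ⟨a * ψ, (integral_abs_condMean_tensorMul_sub_le hX' hX'' a ψ b hδ).trans_lt
      (aux _ hψ'), ?_⟩
    filter_upwards [(tendsto_integral_sq_condMean_sub hX' hX'' hXn' hXn'' hV hC b
      ψ).eventually_lt_const hψ'] with n hn
    exact (integral_abs_condMean_tensorMul_sub_le (hXn' n) (hXn'' n) a ψ b hδ).trans_lt (aux _ hn)
  | zero =>
    intro ε hε
    refine ⟨0, ?_, Eventually.of_forall fun n => ?_⟩ <;> simpa [condMean] using hε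
  | add φ₁ φ₂ _ _ ih₁ ih₂ =>
    intro ε hε
    obtain ⟨Φ₁, h₁, hn₁⟩ := ih₁ (ε / 2) (half_pos hε)
    obtain ⟨Φ₂, h₂, hn₂⟩ := ih₂ (ε / 2) (half_pos hε)
    refine ⟨Φ₁ + Φ₂, (integral_abs_condMean_add_sub_le hV₀ hX' φ₁ φ₂ Φ₁ Φ₂).trans_lt
      (by linarith), ?_⟩
    filter_upwards [hn₁, hn₂] with n h1 h2
    exact (integral_abs_condMean_add_sub_le ((hXn' n).prodMk (hXn'' n)) (hXn' n) φ₁ φ₂ Φ₁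
      Φ₂).trans_lt (by linarith)
  | smul c φ _ ih =>
    intro ε hε
    have hc : 0 < |c| + 1 := by positivity
    obtain ⟨Φ, h₁, hn⟩ := ih (ε / (|c| + 1)) (by positivity)
    rw [lt_div_iff₀ hc] at h₁
    have aux : ∀ I : ℝ, 0 ≤ I → I * (|c| + 1) < ε → |c| * I < ε := fun I h0 hI => by nlinarith
    refine ⟨c • Φ, ?_, ?_⟩
    · rw [integral_abs_condMean_smul_sub]
      exact aux _ (integral_nonneg fun _ => abs_nonneg _) h₁
    · filter_upwards [hn] with n h
      rw [lt_div_iff₀ hc] at h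
      rw [integral_abs_condMean_smul_sub]
      exact aux _ (integral_nonneg fun _ => abs_nonneg _) h

/-- If `(Xn', Xn'')` converges jointly with the conditional laws, and `Xn''` converges weakly given
`Xn'`, then conditioning on the coarser `Xn'` preserves the agreement with the bootstrap law. -/
lemma tendsto_integral_abs_condMean_sub_of_coarser {S : Type*} [TopologicalSpace S]
    {𝓧 𝓓 : ℕ → Type*} [∀ n, MeasurableSpace (𝓧 n)] [∀ n, MeasurableSpace (𝓓 n)]
    {g : S →ᵇ ℝ} {Z Z' : ∀ n, Ω n → S} {X : ∀ n, Ω n → 𝓧 n} {D : ∀ n, Ω n → 𝓓 n} {Z₀ : Ω₀ → S}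
    (hX : ∀ n, Measurable (X n)) (hX' : Measurable X') (hX'' : Measurable X'')
    (hXn' : ∀ n, Measurable[sigmaOf (X n)] (Xn' n)) (hXn'' : ∀ n, Measurable (Xn'' n))
    (hC : CondWeakConv P P₀ Xn'' Xn' X'' X')
    (h : TendstoInDistribution
      (fun n ω => (condMean (P n) g (Z n) (X n) ω, condMean (P n) g (Z' n) (D n) ω,
        (Xn' n ω, Xn'' n ω))) atTop
      (fun ω => (condMean P₀ g Z₀ (fun ω => (X' ω, X'' ω)) ω, condMean P₀ g Z₀ X' ω,
        (X' ω, X'' ω))) P P₀) :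
    Tendsto (fun n => ∫ ω, |condMean (P n) g (Z n) (Xn' n) ω -
      condMean (P n) g (Z' n) (D n) ω| ∂P n) atTop (𝓝 0) := by
  have hXn'm : ∀ n, Measurable (Xn' n) := fun n => (hXn' n).mono (hX n).comap_le le_rfl
  have hVm : Measurable fun ω => (X' ω, X'' ω) := hX'.prodMk hX''
  have hVnm : ∀ n, Measurable fun ω => (Xn' n ω, Xn'' n ω) := fun n => (hXn'm n).prodMk (hXn'' n)
  have hX'V : Measurable[sigmaOf fun ω => (X' ω, X'' ω)] X' :=
    measurable_fst.comp (comap_measurable fun ω => (X' ω, X'' ω))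
  rw [tendsto_order]
  refine ⟨fun c hc => Eventually.of_forall fun n =>
    hc.trans_le (integral_nonneg fun _ => abs_nonneg _), fun ε hε => ?_⟩
  -- Budget for large `n`: `2 * δ` for replacing `g` by `φ`, `δ` for replacing the conditional mean
  -- of `φ` by `Φ`, and `3 * δ` between `Φ` and the bootstrap conditional mean.
  obtain ⟨δ, hδ, rfl⟩ : ∃ δ : ℝ, 0 < δ ∧ ε = 6 * δ := ⟨ε / 6, by positivity, by ring⟩
  obtain ⟨φ, hφ, hφδ⟩ := exists_span_integral_sq_condMean_sub_lt (P := P₀) g Z₀ hVm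
    (show 0 < δ ^ 2 by positivity)
  obtain ⟨Φ, hΦ, hΦn⟩ := exists_integral_abs_condMean_sub_lt hX' hX'' hXn'm hXn'' h.snd.snd hC
    hφ δ hδ
  have hU : ∫ ω, |condMean P₀ g Z₀ (fun ω => (X' ω, X'' ω)) ω - φ (X' ω, X'' ω)| ∂P₀ <
      2 * δ := by
    refine (integral_abs_le_add_integral_sq_div ((memLp_condMean (P := P₀) g Z₀ _).sub
      (memLp_comp_boundedContinuous (P := P₀) φ hVm)) hδ).trans_lt ?_
    have : (∫ ω, (condMean P₀ g Z₀ (fun ω => (X' ω, X'' ω)) ω - φ (X' ω, X'' ω)) ^ 2 ∂P₀) / δ <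
        δ := by rw [div_lt_iff₀ hδ]; nlinarith
    simp only [Pi.sub_apply]
    linarith
  -- In the limit the tower property makes `Φ` close to the conditional mean given `X'`, which is
  -- the limit of the bootstrap conditional means.
  have hV : ∫ ω, |condMean P₀ g Z₀ X' ω - Φ (X' ω)| ∂P₀ < 3 * δ := by
    have h1 := integral_abs_sub_le (P := P₀) (integrable_condMean g Z₀ X')
      (integrable_condMean φ (fun ω => (X' ω, X'' ω)) X') (integrable_comp_boundedContinuous Φ hX')
    have h2 := integral_abs_condMean_sub_condMean_le (P := P₀) g Z₀ hVm hX'V φ hVm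
    linarith
  have tU := h.tendsto_integral_of_ae_bdd (f := fun p => |p.1 - φ p.2.2|) (by fun_prop)
    (‖g‖ + ‖φ‖) (fun n => by
      filter_upwards [abs_condMean_le (P := P n) g (Z n) (X n)] with ω hω
      exact abs_sub_le_of_abs_le hω (φ.norm_coe_le_norm _)) (by
      filter_upwards [abs_condMean_le (P := P₀) g Z₀ (fun ω => (X' ω, X'' ω))] with ω hω
      exact abs_sub_le_of_abs_le hω (φ.norm_coe_le_norm _))
  have tV := h.tendsto_integral_of_ae_bdd (f := fun p => |p.2.1 - Φ p.2.2.1|) (by fun_prop)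
    (‖g‖ + ‖Φ‖) (fun n => by
      filter_upwards [abs_condMean_le (P := P n) g (Z' n) (D n)] with ω hω
      exact abs_sub_le_of_abs_le hω (Φ.norm_coe_le_norm _)) (by
      filter_upwards [abs_condMean_le (P := P₀) g Z₀ X'] with ω hω
      exact abs_sub_le_of_abs_le hω (Φ.norm_coe_le_norm _))
  filter_upwards [hΦn, tU.eventually_lt_const hU, tV.eventually_lt_const hV] with n h1 h2 h3
  have e1 := integral_abs_condMean_sub_condMean_le (P := P n) g (Z n) (hX n) (hXn' n) φ (hVnm n)
  have e2 := integral_abs_sub_le (P := P n) (integrable_condMean g (Z n) (Xn' n))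
    (integrable_condMean φ (fun ω => (Xn' n ω, Xn'' n ω)) (Xn' n))
    (integrable_comp_boundedContinuous Φ (hXn'm n))
  have e3 := integral_abs_sub_le (P := P n) (integrable_condMean g (Z n) (Xn' n))
    (integrable_comp_boundedContinuous Φ (hXn'm n)) (integrable_condMean g (Z' n) (D n))
  simp_rw [abs_sub_comm (Φ _)] at e3
  linarith

end Limits

/-- `T n` and `Ts n` are the functions giving the original statistic `τₙ = T n (Dₙ)` and the
bootstrap statistic `τₙ* = Ts n (Dₙ, Wₙ*)`; the limit variables live on `(Ω₀, P₀)`. -/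
theorem corollaryc1
    {Ω : ℕ → Type*} [∀ n, MeasurableSpace (Ω n)]
    (P : ∀ n, Measure (Ω n)) [∀ n, IsProbabilityMeasure (P n)]
    {𝓓 𝓦 𝓧 : ℕ → Type*}
    [∀ n, TopologicalSpace (𝓓 n)] [∀ n, PolishSpace (𝓓 n)]
    [∀ n, MeasurableSpace (𝓓 n)] [∀ n, BorelSpace (𝓓 n)]
    [∀ n, TopologicalSpace (𝓦 n)] [∀ n, PolishSpace (𝓦 n)]
    [∀ n, MeasurableSpace (𝓦 n)] [∀ n, BorelSpace (𝓦 n)]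
    [∀ n, TopologicalSpace (𝓧 n)] [∀ n, PolishSpace (𝓧 n)]
    [∀ n, MeasurableSpace (𝓧 n)] [∀ n, BorelSpace (𝓧 n)]
    (D : ∀ n, Ω n → 𝓓 n) (hD : ∀ n, Measurable (D n))
    (W : ∀ n, Ω n → 𝓦 n) (hW : ∀ n, Measurable (W n))
    (T : ∀ n, 𝓓 n → ℝ) (hT : ∀ n, Measurable (T n))
    (Ts : ∀ n, 𝓓 n × 𝓦 n → ℝ) (hTs : ∀ n, Measurable (Ts n))
    (τn τsn : ∀ n, Ω n → ℝ)
    (hτn : ∀ n ω, τn n ω = T n (D n ω)) (hτsn : ∀ n ω, τsn n ω = Ts n (D n ω, W n ω))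
    (Xn : ∀ n, Ω n → 𝓧 n) (hXn : ∀ n, Measurable[sigmaOf (D n)] (Xn n))
    {Ω₀ : Type*} [MeasurableSpace Ω₀] (P₀ : Measure Ω₀) [IsProbabilityMeasure P₀]
    (τ : Ω₀ → ℝ) (hτ : Measurable τ)
    {𝓢 𝓢' 𝓢'' : Type*}
    [TopologicalSpace 𝓢] [PolishSpace 𝓢] [MeasurableSpace 𝓢] [BorelSpace 𝓢]
    [TopologicalSpace 𝓢'] [PolishSpace 𝓢'] [MeasurableSpace 𝓢'] [BorelSpace 𝓢']
    [TopologicalSpace 𝓢''] [PolishSpace 𝓢''] [MeasurableSpace 𝓢''] [BorelSpace 𝓢''] :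
    -- (a) the case `X' = X`
    (∀ X : Ω₀ → 𝓢, Measurable X →
      JointCondWeakConv P P₀ τn Xn τsn D τ X τ X →
      SamplePathContinuousCdf P₀ τ X →
        BootstrapValidConditionally P D τn τsn Xn ∧
        CondCdfsUniformlyClose P D τn τsn Xn) ∧
    -- (b) the case `X = (X', X'')`
    (∀ (X' : Ω₀ → 𝓢') (X'' : Ω₀ → 𝓢''), Measurable X' → Measurable X'' →
      ∀ (Xn' : ∀ n, Ω n → 𝓢') (Xn'' : ∀ n, Ω n → 𝓢''),
      (∀ n, Measurable[sigmaOf (Xn n)] (Xn' n)) →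
      (∀ n, Measurable[sigmaOf (Xn n)] (Xn'' n)) →
      JointCondWeakConvWith P P₀ τn Xn τsn D (fun n ω => (Xn' n ω, Xn'' n ω))
        τ (fun ω => (X' ω, X'' ω)) τ X' (fun ω => (X' ω, X'' ω)) →
      SamplePathContinuousCdf P₀ τ (fun ω => (X' ω, X'' ω)) →
      SamplePathContinuousCdf P₀ τ X' →
      CondWeakConv P P₀ Xn'' Xn' X'' X' →
        BootstrapValidConditionally P D τn τsn Xn' ∧
        CondCdfsUniformlyClose P D τn τsn Xn') := by
  have hτnm : ∀ n, Measurable (τn n) := fun n => by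
    rw [show τn n = T n ∘ D n from funext (hτn n)]
    exact (hT n).comp (hD n)
  have hτsnm : ∀ n, Measurable (τsn n) := fun n => by
    rw [show τsn n = Ts n ∘ fun ω => (D n ω, W n ω) from funext (hτsn n)]
    exact (hTs n).comp ((hD n).prodMk (hW n))
  have hXnm : ∀ n, Measurable (Xn n) := fun n => (hXn n).mono (hD n).comap_le le_rfl
  refine ⟨fun X hX hjoint hc => ?_, fun X' X'' hX' hX'' Xn' Xn'' hXn' hXn'' hjoint _ hc hcond => ?_⟩
  · have h := fun η (hη : 0 < η) => eventually_exists_error hτnm hτsnm hD hXnm hτ hX hc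
      (fun g => tendsto_integral_abs_condMean_sub_of_joint (hjoint g g))
      (fun g => tendsto_integral_condMean_sq (hjoint g g).snd) hη
    exact ⟨bootstrapValid_of_eventually_exists_error hT hτn hτsnm hD hXnm h,
      condCdfsUniformlyClose_of_eventually_exists_error h⟩
  · have hXn'm : ∀ n, Measurable (Xn' n) := fun n => (hXn' n).mono (hXnm n).comap_le le_rfl
    have hXn''m : ∀ n, Measurable (Xn'' n) := fun n => (hXn'' n).mono (hXnm n).comap_le le_rfl
    have h := fun η (hη : 0 < η) => eventually_exists_error hτnm hτsnm hD hXn'm hτ hX' hc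
      (fun g => tendsto_integral_abs_condMean_sub_of_coarser hXnm hX' hX'' hXn' hXn''m
        hcond (hjoint g g))
      (fun g => tendsto_integral_condMean_sq (hjoint g g).snd.fst) hη
    exact ⟨bootstrapValid_of_eventually_exists_error hT hτn hτsnm hD hXn'm h,
      condCdfsUniformlyClose_of_eventually_exists_error h⟩
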